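/- Let $K$ be a field and $G$ a finite simple graph with vertex set $V$. Let $S=K[x_v,y_v : v\in V]$ with the standard grading, and let $J_G\subseteq S$ be the binomial edge ideal of $G$, generated by the binomials $x_vy_w-x_wy_v$ with $\{v,w\}\in E(G)$. For a finitely generated graded $S$-module $M$, let $\beta_{i,j}(M)$ be the number of generators of degree $j$ in the $i$-th module ($i\ge 0$, starting with the generators of $M$) of the minimal graded free resolution of $M$, let $\mathrm{pd}(M)$ be the projective dimension of $M$, and for $M\neq 0$ let $\mathrm{reg}(M)=\max\{j-i : \beta_{i,j}(M)\neq 0\}$. The ideal $J_G$ is regarded as a graded $S$-module. For an edge $e$ of $G$ let $G\setminus e$ be the graph on $V$ obtained by deleting $e$. Let $e$ be a free cut edge of $G$, that is, an edge such that $G\setminus e$ has more connected components than $G$ and such that each of the two endpoints of $e$ is a free vertex of $G\setminus e$, i.e. lies in exactly one maximal clique of $G\setminus e$. Then: (a) $\beta_{i,j}(J_G)=\beta_{i,j}(J_{G\setminus e})+\beta_{i-1,j-2}(J_{G\setminus e})$ for all integers $i,j\geq 1$; (b) if $G\setminus e$ has at least one edge, then $\mathrm{pd}(J_G)=\mathrm{pd}(J_{G\setminus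 e})+1$; (c) if $G\setminus e$ has at least one edge, then $\mathrm{reg}(J_G)=\mathrm{reg}(J_{G\setminus e})+1$. If $G\setminus e$ has no edges, so that $J_{G\setminus e}=0$, then $\mathrm{pd}(J_G)=0$ and $\mathrm{reg}(J_G)=2$ (so (b) and (c) remain true with the conventions $\mathrm{pd}(0)=-1$ and $\mathrm{reg}(0)=1$, which amount to $\mathrm{pd}(J)=\mathrm{pd}(S/J)-1$ and $\mathrm{reg}(J)=\mathrm{reg}(S/J)+1$). -/

import Mathlib

/-! ### Graphs -/

namespace SimpleGraph

variable {V : Type*}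

/-- `v` is a free vertex of `G`: it lies in exactly one facet of the clique complex of `G`,
that is, in exactly one maximal clique of `G`. -/
def IsFreeVertex (G : SimpleGraph V) (v : V) : Prop :=
  ∃! F : Set V, Maximal G.IsClique F ∧ v ∈ F

/-- `e` is a cut edge of the (finite) graph `G`: it is an edge of `G`, and the graph `G ∖ e`
obtained by deleting it has more connected components than `G`. -/
def IsCutEdge (G : SimpleGraph V) (e : Sym2 V) : Prop :=
  e ∈ G.edgeSet ∧
    Nat.card G.ConnectedComponent < Nat.card (G.deleteEdges {e}).ConnectedComponent

/-- `e` is a free cut edge of `G`: a cut edge both of whose endpoints are free vertices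
of `G ∖ e`. -/
def IsFreeCutEdge (G : SimpleGraph V) (e : Sym2 V) : Prop :=
  G.IsCutEdge e ∧ ∀ v ∈ e, (G.deleteEdges {e}).IsFreeVertex v

end SimpleGraph

/-! ### Graded free resolutions, Betti numbers and regularity -/

namespace GradedBetti

open MvPolynomial

variable {σ K : Type*} [Field K]

/-- The standard `ℤ`-grading of `S = K[x_s : s ∈ σ]`: the homogeneous polynomials of degree `j`
(only `0` when `j < 0`). -/
noncomputable def polyGrading (σ K : Type*) [Field K] (j : ℤ) :
    Submodule K (MvPolynomial σ K) :=
  weightedHomogeneousSubmodule K (fun _ : σ => (1 : ℤ)) j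

/-- The grading induced on a homogeneous ideal `J` of `S`, regarded as a graded `S`-module:
`J_j = J ∩ S_j`. -/
noncomputable def idealGrading (J : Ideal (MvPolynomial σ K)) (j : ℤ) : Submodule K J :=
  (polyGrading σ K j).comap (J.subtype.restrictScalars K)

/-- A graded free resolution `⋯ → F₁ → F₀ → M → 0`, with free modules of finite rank, of a
`ℤ`-graded module `M = ⨁ 𝓜 j` over the standard graded polynomial ring `S`.  Here
`F_i = ⨁_a S(-deg i a)` is free on a homogeneous basis indexed by `Fin (rank i)`, the `a`-th
basis vector having degree `deg i a`, and all maps are homogeneous of degree `0`. -/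
structure GradedFreeResolution {M : Type*} [AddCommGroup M] [Module K M]
    [Module (MvPolynomial σ K) M] [IsScalarTower K (MvPolynomial σ K) M]
    (𝓜 : ℤ → Submodule K M) where
  /-- the rank of `F_i` -/
  rank : ℕ → ℕ
  /-- the degrees of the basis vectors of `F_i` -/
  deg : (i : ℕ) → Fin (rank i) → ℤ
  /-- the differential `F_{i+1} → F_i` -/
  d : (i : ℕ) →
    (Fin (rank (i + 1)) → MvPolynomial σ K) →ₗ[MvPolynomial σ K]
      (Fin (rank i) → MvPolynomial σ K)
  /-- the augmentation `F_0 → M` -/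
  ε : (Fin (rank 0) → MvPolynomial σ K) →ₗ[MvPolynomial σ K] M
  d_homogeneous : ∀ (i : ℕ) (b : Fin (rank (i + 1))) (a : Fin (rank i)),
    d i (Pi.single b 1) a ∈ polyGrading σ K (deg (i + 1) b - deg i a)
  ε_homogeneous : ∀ a : Fin (rank 0), ε (Pi.single a 1) ∈ 𝓜 (deg 0 a)
  exact_d : ∀ i : ℕ, Function.Exact (d (i + 1)) (d i)
  exact_ε : Function.Exact (d 0) ε
  surjective_ε : Function.Surjective ε

section

variable {M : Type*} [AddCommGroup M] [Module K M] [Module (MvPolynomial σ K) M]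
  [IsScalarTower K (MvPolynomial σ K) M] {𝓜 : ℤ → Submodule K M}

/-- A graded free resolution is minimal if every differential `F_{i+1} → F_i` has image in
`𝔪 F_i`, where `𝔪` is the ideal generated by the variables (the polynomials whose constant
coefficient is `0`). -/
def GradedFreeResolution.IsMinimal (F : GradedFreeResolution (σ := σ) 𝓜) : Prop :=
  ∀ (i : ℕ) (x : Fin (F.rank (i + 1)) → MvPolynomial σ K) (a : Fin (F.rank i)),
    constantCoeff (F.d i x a) = 0

end

open Classical in
/-- The graded Betti number `β_{i,j}(M)` of a finitely generated graded `S`-module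
`M = ⨁ 𝓜 j`: the number of basis vectors of degree `j` in the `i`-th module of a minimal graded
free resolution of `M` (which exists for finitely many variables and is unique up to
isomorphism). -/
noncomputable def betti (σ : Type*) {K M : Type*} [Field K] [AddCommGroup M] [Module K M]
    [Module (MvPolynomial σ K) M] [IsScalarTower K (MvPolynomial σ K) M]
    (𝓜 : ℤ → Submodule K M) (i : ℕ) (j : ℤ) : ℕ :=
  if h : ∃ F : GradedFreeResolution (σ := σ) 𝓜, F.IsMinimal then
    Nat.card {a : Fin (h.choose.rank i) // h.choose.deg i a = j}
  else 0

/-- The Castelnuovo–Mumford regularity `max {j - i : β_{i,j}(M) ≠ 0}` of a finitely generated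
graded `S`-module `M ≠ 0`. -/
noncomputable def regularity (σ : Type*) {K M : Type*} [Field K] [AddCommGroup M] [Module K M]
    [Module (MvPolynomial σ K) M] [IsScalarTower K (MvPolynomial σ K) M]
    (𝓜 : ℤ → Submodule K M) : ℤ :=
  sSup {r : ℤ | ∃ (i : ℕ) (j : ℤ), betti σ 𝓜 i j ≠ 0 ∧ r = j - i}

end GradedBetti

/-! ### Binomial edge ideals -/

namespace BinomialEdgeIdeal

open MvPolynomial GradedBetti

variable (K : Type*) [Field K] {V : Type*}

/-- The binomial edge ideal `J_G = (x_v y_w - x_w y_v : {v, w} ∈ E(G))` of `G` in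
`S = K[x_v, y_v : v ∈ V]`, where `x_v = X (Sum.inl v)` and `y_v = X (Sum.inr v)`. (Exchanging `v`
and `w` changes only the sign of the generator.) -/
noncomputable def binomialEdgeIdeal (G : SimpleGraph V) : Ideal (MvPolynomial (V ⊕ V) K) :=
  Ideal.span {f | ∃ v w : V, G.Adj v w ∧
    f = X (Sum.inl v) * X (Sum.inr w) - X (Sum.inl w) * X (Sum.inr v)}

/-- The graded Betti number `β_{i,j}(J_G)` of the graded `S`-module `J_G`. -/
noncomputable def bettiJ (G : SimpleGraph V) (i : ℕ) (j : ℤ) : ℕ :=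
  betti (V ⊕ V) (idealGrading (binomialEdgeIdeal K G)) i j

/-- The projective dimension `pd(J_G)` of the `S`-module `J_G` (equal to `⊥` if `J_G = 0`). -/
noncomputable def pdJ (G : SimpleGraph V) : WithBot ℕ∞ :=
  CategoryTheory.projectiveDimension
    (ModuleCat.of (MvPolynomial (V ⊕ V) K) (binomialEdgeIdeal K G))

/-- The Castelnuovo–Mumford regularity `reg(J_G)` of the graded `S`-module `J_G`. -/
noncomputable def regJ (G : SimpleGraph V) : ℤ :=
  regularity (V ⊕ V) (idealGrading (binomialEdgeIdeal K G))

end BinomialEdgeIdeal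

/-! ### The binomial edge ideal as a space of relations between monomials -/

/-! Write `e = {u, v}`, `J = J_{G ∖ e}` and `f = x_u y_v - x_v y_u`, so that `J_G = J + (f)`.
Everything rests on `f` being a nonzerodivisor modulo `J` (`mem_of_mul_edgeBinomial_mem`).
Multiplication by `f` on the minimal resolution of `S/J` then has as mapping cone a resolution of
`S/J_G`, and this cone is minimal because `f` and `J` lie in the ideal of the variables. Its module
in degree `i` is `F_i ⊕ F_{i-1}(-2)`, from which Betti numbers, projective dimension and regularity
are read off.

For the nonzerodivisor property, give weight `1` to the `x`-variables of the component of `u` in `G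
∖ e` and weight `0` to all other variables. Since `v` lies in another component, `J` is homogeneous
and `f` has leading form `x_u y_v`; it suffices that `x_u` and `y_v` are nonzerodivisors modulo `J`.
This is seen on monomials: two monomials agree modulo a binomial edge ideal iff they have the same
degree at every vertex and the same `x`-degree on every component of the graph induced on their
support (`mem_binomialEdgeIdeal_iff`). Multiplying by a variable at a free vertex merges no
components among the other vertices, because the neighbours of that vertex are already adjacent to
each other; so distinct classes stay distinct.

The homological part is standard: minimal resolutions exist by graded Nakayama, their degrees are
unique by comparison of resolutions, they are finite by Hilbert's syzygy theorem, and their length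
is the projective dimension. -/

namespace BinomialEdgeIdeal

open MvPolynomial GradedBetti

section Monomials

variable {K : Type*} [Field K] {σ Q Q' : Type*}

/-- The linear map on polynomials that sends a monomial `m` to the basis vector `φ m`. -/
noncomputable def classSum (K : Type*) [Field K] (φ : (σ →₀ ℕ) → Q) :
    MvPolynomial σ K →ₗ[K] (Q →₀ K) :=
  (basisMonomials σ K).constr K fun m => Finsupp.single (φ m) 1

lemma classSum_monomial_one (φ : (σ →₀ ℕ) → Q) (m : σ →₀ ℕ) :
    classSum K φ (monomial m 1) = Finsupp.single (φ m) 1 := by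
  have := (basisMonomials σ K).constr_basis K (fun m => Finsupp.single (φ m) (1 : K)) m
  simpa [classSum] using this

lemma linearMap_ext_monomial {M : Type*} [AddCommGroup M] [Module K M]
    {f g : MvPolynomial σ K →ₗ[K] M} (h : ∀ m, f (monomial m 1) = g (monomial m 1)) : f = g :=
  (basisMonomials σ K).ext fun m => by simpa using h m

lemma classSum_eq_zero_of_factor {φ : (σ →₀ ℕ) → Q} {ψ : (σ →₀ ℕ) → Q'}
    (h : ∀ m m', φ m = φ m' → ψ m = ψ m') {g : MvPolynomial σ K} (hg : classSum K φ g = 0) :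
    classSum K ψ g = 0 := by
  classical
  obtain ⟨F, rfl⟩ : ∃ F : Q → Q', ψ = F ∘ φ := by
    have : Nonempty Q' := ⟨ψ 0⟩
    exact ⟨ψ ∘ Function.invFun φ, funext fun m =>
      h _ _ (Function.invFun_eq (f := φ) ⟨m, rfl⟩).symm⟩
  have : classSum K (F ∘ φ) = (Finsupp.lmapDomain K K F) ∘ₗ classSum K φ :=
    linearMap_ext_monomial fun m => by simp [classSum_monomial_one]
  simp [this, hg]

/-- A choice of representatives defines a linear map from the span of the classes to `S/J`, and the
quotient map factors through it. -/
lemma mem_of_classSum_eq_zero {φ : (σ →₀ ℕ) → Q} {J : Ideal (MvPolynomial σ K)}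
    (h : ∀ m m', φ m = φ m' → (monomial m 1 - monomial m' 1 : MvPolynomial σ K) ∈ J)
    {g : MvPolynomial σ K} (hg : classSum K φ g = 0) : g ∈ J := by
  let R : (Q →₀ K) →ₗ[K] (MvPolynomial σ K ⧸ J) :=
    Finsupp.lsum K fun q => LinearMap.toSpanSingleton K _
      (Ideal.Quotient.mk J (monomial (Function.invFun φ q) 1))
  have hR : R ∘ₗ classSum K φ = (Ideal.Quotient.mkₐ K J).toLinearMap := by
    refine linearMap_ext_monomial fun m => ?_
    simp only [LinearMap.comp_apply, classSum_monomial_one, R, Finsupp.lsum_single,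
      LinearMap.toSpanSingleton_apply, one_smul, AlgHom.toLinearMap_apply,
      Ideal.Quotient.mkₐ_eq_mk]
    exact Ideal.Quotient.eq.mpr (h _ _ (Function.invFun_eq (f := φ) ⟨m, rfl⟩))
  have := LinearMap.congr_fun hR g
  simp only [LinearMap.comp_apply, hg, map_zero, AlgHom.toLinearMap_apply,
    Ideal.Quotient.mkₐ_eq_mk] at this
  exact Ideal.Quotient.eq_zero_iff_mem.mp this.symm

end Monomials

/-! ### Monomials modulo a binomial edge ideal -/

section Invariant

variable {K : Type*} [Field K] {V : Type*}

/-- The binomial `x_v y_w - x_w y_v`. -/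
noncomputable def edgeBinomial (K : Type*) [Field K] (v w : V) : MvPolynomial (V ⊕ V) K :=
  X (Sum.inl v) * X (Sum.inr w) - X (Sum.inl w) * X (Sum.inr v)

lemma edgeBinomial_mem {G : SimpleGraph V} {v w : V} (h : G.Adj v w) :
    edgeBinomial K v w ∈ binomialEdgeIdeal K G :=
  Ideal.subset_span ⟨v, w, h, rfl⟩

/-- The subgraph of `G` formed by the edges whose two ends lie in the support of `c`. -/
def supportGraph (G : SimpleGraph V) (c : V → ℕ) : SimpleGraph V where
  Adj v w := G.Adj v w ∧ c v ≠ 0 ∧ c w ≠ 0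
  symm := ⟨fun _ _ h => ⟨h.1.symm, h.2.2, h.2.1⟩⟩
  loopless := ⟨fun _ h => h.1.ne rfl⟩

/-- The total degree of the monomial `m` in the two variables `x_v` and `y_v`. -/
def vertexDegree (m : V ⊕ V →₀ ℕ) (v : V) : ℕ := m (Sum.inl v) + m (Sum.inr v)

open Classical in
/-- The degree of the monomial `m` in the variables `x_w` with `w` in the component of `v` in
the support graph of `c`. -/
noncomputable def componentDegree [Fintype V] (G : SimpleGraph V) (c : V → ℕ)
    (m : V ⊕ V →₀ ℕ) (v : V) : ℕ :=
  ∑ w with (supportGraph G c).Reachable v w, m (Sum.inl w)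

/-- The invariant that classifies monomials modulo the binomial edge ideal. -/
noncomputable def invariant [Fintype V] (G : SimpleGraph V) (m : V ⊕ V →₀ ℕ) :
    (V → ℕ) × (V → ℕ) :=
  (vertexDegree m, componentDegree G (vertexDegree m) m)

/-- Induction along a walk `v, z, …, w`, using `x_z f_{vw} = x_v f_{zw} + x_w f_{vz}` and the same
identity with `y` as the multiplier. The cofactor `p` supplies a variable at each inner vertex. -/
lemma monomial_mul_edgeBinomial_mem {G : SimpleGraph V} {c : V → ℕ} {v w : V}
    (h : (supportGraph G c).Reachable v w) (p : V ⊕ V →₀ ℕ)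
    (hp : ∀ z, c z ≠ 0 → z ≠ v → z ≠ w → vertexDegree p z ≠ 0) :
    monomial p 1 * edgeBinomial K v w ∈ binomialEdgeIdeal K G := by
  classical
  obtain ⟨q⟩ := h
  induction q generalizing p with
  | nil => simp [edgeBinomial]
  | @cons v z w hvz _ ih =>
    by_cases hzw : z = w
    · subst hzw
      exact Ideal.mul_mem_left _ _ (edgeBinomial_mem hvz.1)
    have hd := hp z hvz.2.2 hvz.1.ne' hzw
    -- Trade a variable at `z` for one at `v`. The new cofactor satisfies the hypothesis for the
    -- endpoints `z, w`, even if the rest of the walk returns to `v`.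
    have key : ∀ s t : V ⊕ V, (s = Sum.inl z ∧ t = Sum.inl v ∨ s = Sum.inr z ∧ t = Sum.inr v) →
        p s ≠ 0 → ∃ p' : V ⊕ V →₀ ℕ, p = p' + Finsupp.single s 1 ∧
          monomial p' 1 * X t * edgeBinomial K z w ∈ binomialEdgeIdeal K G := by
      intro s t hst hs
      have hps : p = (p - Finsupp.single s 1) + Finsupp.single s 1 := by
        rw [tsub_add_cancel_of_le]
        simpa using Nat.one_le_iff_ne_zero.mpr hs
      refine ⟨_, hps, ?_⟩
      rw [X, monomial_mul, one_mul]
      refine ih _ fun y hy hyz hyw => ?_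
      by_cases hyv : y = v
      · subst hyv
        rcases hst with ⟨_, rfl⟩ | ⟨_, rfl⟩ <;> simp [vertexDegree]
      · have := hp y hy hyv hyw
        rcases hst with ⟨rfl, rfl⟩ | ⟨rfl, rfl⟩ <;>
          simpa [vertexDegree, Finsupp.single_apply, Ne.symm hyz, Ne.symm hyv] using this
    have hmem := edgeBinomial_mem (K := K) hvz.1
    have hd' : p (Sum.inl z) ≠ 0 ∨ p (Sum.inr z) ≠ 0 := by
      unfold vertexDegree at hd; omega
    rcases hd' with h | h
    · obtain ⟨p', rfl, h1⟩ := key (Sum.inl z) (Sum.inl v) (by simp) h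
      have : monomial (p' + Finsupp.single (Sum.inl z) 1) 1 * edgeBinomial K v w =
          monomial p' 1 * X (Sum.inl v) * edgeBinomial K z w +
          monomial p' 1 * X (Sum.inl w) * edgeBinomial K v z := by
        rw [show (monomial (p' + Finsupp.single (Sum.inl z) 1) (1 : K)) =
          monomial p' 1 * X (Sum.inl z) by rw [X, monomial_mul, one_mul]]
        unfold edgeBinomial; ring
      rw [this]
      exact add_mem h1 (Ideal.mul_mem_left _ _ hmem)
    · obtain ⟨p', rfl, h1⟩ := key (Sum.inr z) (Sum.inr v) (by simp) h
      have : monomial (p' + Finsupp.single (Sum.inr z) 1) 1 * edgeBinomial K v w =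
          monomial p' 1 * X (Sum.inr v) * edgeBinomial K z w +
          monomial p' 1 * X (Sum.inr w) * edgeBinomial K v z := by
        rw [show (monomial (p' + Finsupp.single (Sum.inr z) 1) (1 : K)) =
          monomial p' 1 * X (Sum.inr z) by rw [X, monomial_mul, one_mul]]
        unfold edgeBinomial; ring
      rw [this]
      exact add_mem h1 (Ideal.mul_mem_left _ _ hmem)

/-- The monomial `p x_v y_w`. -/
noncomputable def crossMonomial (p : V ⊕ V →₀ ℕ) (v w : V) : V ⊕ V →₀ ℕ :=
  p + Finsupp.single (Sum.inl v) 1 + Finsupp.single (Sum.inr w) 1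

lemma monomial_crossMonomial_sub (p : V ⊕ V →₀ ℕ) (v w : V) :
    (monomial (crossMonomial p v w) 1 - monomial (crossMonomial p w v) 1 :
      MvPolynomial (V ⊕ V) K) = monomial p 1 * edgeBinomial K v w := by
  have : ∀ v w : V, (monomial (crossMonomial p v w) 1 : MvPolynomial (V ⊕ V) K) =
      monomial p 1 * (X (Sum.inl v) * X (Sum.inr w)) := by
    intro v w
    rw [X, X, monomial_mul, monomial_mul, crossMonomial, one_mul, one_mul, add_assoc]
  rw [this, this, edgeBinomial, mul_sub]

lemma vertexDegree_crossMonomial (p : V ⊕ V →₀ ℕ) (v w : V) :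
    vertexDegree (crossMonomial p v w) = vertexDegree (crossMonomial p w v) := by
  classical
  funext z
  simp only [vertexDegree, crossMonomial, Finsupp.add_apply, Finsupp.single_apply,
    Sum.inl.injEq, Sum.inr.injEq, reduceCtorEq, if_false]
  omega

lemma invariant_crossMonomial [Fintype V] (G : SimpleGraph V) (p : V ⊕ V →₀ ℕ) {v w : V}
    (h : (supportGraph G (vertexDegree (crossMonomial p v w))).Reachable v w) :
    invariant G (crossMonomial p v w) = invariant G (crossMonomial p w v) := by
  classical
  unfold invariant
  rw [vertexDegree_crossMonomial p v w] at h ⊢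
  generalize vertexDegree (crossMonomial p w v) = c at h ⊢
  congr 1
  funext z
  simp only [componentDegree, crossMonomial, Finsupp.add_apply, Finsupp.single_apply,
    Sum.inl.injEq, reduceCtorEq, if_false, add_zero, Finset.sum_add_distrib, Finset.sum_ite_eq]
  congr 1
  refine if_congr ?_ rfl rfl
  simp only [Finset.mem_filter, Finset.mem_univ, true_and]
  exact ⟨fun h' => h'.trans h, fun h' => h'.trans h.symm⟩

lemma classSum_invariant_eq_zero [Fintype V] {G : SimpleGraph V} {g : MvPolynomial (V ⊕ V) K}
    (hg : g ∈ binomialEdgeIdeal K G) : classSum K (invariant G) g = 0 := by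
  classical
  -- Quantifying over all multiples lets the span induction pass through multiplication by ring
  -- elements.
  suffices h : ∀ a, classSum K (invariant G) (a * g) = 0 by simpa using h 1
  induction hg using Submodule.span_induction with
  | mem f hf =>
    obtain ⟨v, w, h, rfl⟩ := hf
    suffices H : classSum K (invariant G) ∘ₗ LinearMap.mulRight K (edgeBinomial K v w) = 0 from
      fun a => LinearMap.congr_fun H a
    refine linearMap_ext_monomial fun p => ?_
    rw [LinearMap.comp_apply, LinearMap.mulRight_apply, ← monomial_crossMonomial_sub, map_sub,
      classSum_monomial_one, classSum_monomial_one, invariant_crossMonomial, sub_self,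
      LinearMap.zero_apply]
    refine SimpleGraph.Adj.reachable ⟨h, ?_, ?_⟩ <;> simp [vertexDegree, crossMonomial]
  | zero => simp
  | add f g _ _ hf hg => intro a; rw [mul_add, map_add, hf, hg, add_zero]
  | smul b f _ hf => intro a; rw [smul_eq_mul, ← mul_assoc]; exact hf _

lemma exists_crossMonomial_eq {m : V ⊕ V →₀ ℕ} {v w : V} (hv : m (Sum.inl v) ≠ 0)
    (hw : m (Sum.inr w) ≠ 0) : ∃ p, m = crossMonomial p v w := by
  classical
  refine ⟨m - (Finsupp.single (Sum.inl v) 1 + Finsupp.single (Sum.inr w) 1), ?_⟩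
  rw [crossMonomial, add_assoc, tsub_add_cancel_of_le]
  intro s
  rcases s with s | s
  · by_cases h : v = s
    · subst h; simpa using Nat.one_le_iff_ne_zero.mpr hv
    · simp [h]
  · by_cases h : w = s
    · subst h; simpa using Nat.one_le_iff_ne_zero.mpr hw
    · simp [h]

/-- An excess of `x_v` in `m` over `m'` is balanced by a deficit of some `x_w` in the same
component. Replacing `x_v y_w` by `x_w y_v` changes `m` by an element of the ideal and brings it
closer to `m'`. -/
lemma monomial_sub_mem_of_invariant_eq [Fintype V] (G : SimpleGraph V) (m m' : V ⊕ V →₀ ℕ)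
    (h : invariant G m = invariant G m') :
    (monomial m 1 - monomial m' 1 : MvPolynomial (V ⊕ V) K) ∈ binomialEdgeIdeal K G := by
  classical
  -- Truncated subtraction: `n` counts only the excess of `m` over `m'`.
  obtain ⟨n, hn⟩ : ∃ n, ∑ v, (m (Sum.inl v) - m' (Sum.inl v)) = n := ⟨_, rfl⟩
  induction n using Nat.strong_induction_on generalizing m with
  | _ n ih =>
  have hc : vertexDegree m = vertexDegree m' := congrArg Prod.fst h
  have hs : componentDegree G (vertexDegree m) m = componentDegree G (vertexDegree m) m' := by
    have := congrArg Prod.snd h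
    simpa only [invariant, ← hc] using this
  by_cases hle : ∀ v, m (Sum.inl v) ≤ m' (Sum.inl v)
  · have hx : ∀ v, m (Sum.inl v) = m' (Sum.inl v) := fun v =>
      (Finset.sum_eq_sum_iff_of_le fun i _ => hle i).mp (congrFun hs v) v (by simp)
    have : m = m' := by
      ext s
      rcases s with s | s
      · exact hx s
      · have := congrFun hc s
        simp only [vertexDegree, hx s] at this
        omega
    simp [this]
  · push Not at hle
    obtain ⟨v, hv⟩ := hle
    obtain ⟨w, hvw, hw⟩ : ∃ w, (supportGraph G (vertexDegree m)).Reachable v w ∧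
        m (Sum.inl w) < m' (Sum.inl w) := by
      by_contra! hcon
      refine absurd (congrFun hs v) (ne_of_gt ?_)
      exact Finset.sum_lt_sum (fun i hi => hcon i (Finset.mem_filter.mp hi).2)
        ⟨v, by simp, hv⟩
    -- The degrees at `w` agree while `m` has fewer `x_w`, so `y_w` divides `m`.
    have hwr : m (Sum.inr w) ≠ 0 := by
      have := congrFun hc w
      simp only [vertexDegree] at this
      omega
    have hne : v ≠ w := by rintro rfl; omega
    obtain ⟨p, rfl⟩ := exists_crossMonomial_eq (by omega : m (Sum.inl v) ≠ 0) hwr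
    have h1 : (monomial (crossMonomial p v w) 1 - monomial (crossMonomial p w v) 1 :
        MvPolynomial (V ⊕ V) K) ∈ binomialEdgeIdeal K G := by
      rw [monomial_crossMonomial_sub]
      refine monomial_mul_edgeBinomial_mem hvw p fun z hz hzv hzw => ?_
      simpa [vertexDegree, crossMonomial, Finsupp.single_apply, Ne.symm hzv, Ne.symm hzw]
        using hz
    have h2 := ih (∑ z, (crossMonomial p w v (Sum.inl z) - m' (Sum.inl z))) (by
        rw [← hn]
        refine Finset.sum_lt_sum (fun z _ => ?_) ⟨v, Finset.mem_univ _, ?_⟩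
        · by_cases hzw : w = z
          · subst hzw
            simp [crossMonomial, hne] at hw ⊢
            omega
          · simp only [crossMonomial, Finsupp.add_apply, Finsupp.single_apply, Sum.inl.injEq,
              reduceCtorEq, if_false, hzw]
            omega
        · simp [crossMonomial, hne] at hv ⊢
          omega) _ ((invariant_crossMonomial G p hvw).symm.trans h) rfl
    simpa using add_mem h1 h2

theorem mem_binomialEdgeIdeal_iff [Fintype V] {G : SimpleGraph V}
    {g : MvPolynomial (V ⊕ V) K} :
    g ∈ binomialEdgeIdeal K G ↔ classSum K (invariant G) g = 0 :=
  ⟨classSum_invariant_eq_zero,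
    mem_of_classSum_eq_zero (monomial_sub_mem_of_invariant_eq G)⟩

end Invariant

/-! ### Variables at a vertex whose neighbourhood is a clique -/

section FreeVertex

variable {K : Type*} [Field K] {V : Type*}

/-- A walk through `u` can be shortcut: the vertices before and after `u` are neighbours of `u`,
hence equal or adjacent. -/
lemma supportGraph_reachable_of_add {G : SimpleGraph V} {u : V}
    (hu : ∀ s t, G.Adj u s → G.Adj u t → s ≠ t → G.Adj s t) {c c' : V → ℕ}
    (hc : ∀ z, z ≠ u → c' z = c z) {v w : V} (hv : v ≠ u) (hw : w ≠ u)
    (h : (supportGraph G c').Reachable v w) : (supportGraph G c).Reachable v w := by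
  -- For a walk that currently ends at `u`, the induction records that every possible next vertex is
  -- already reachable without `u`.
  suffices H : (w ≠ u → (supportGraph G c).Reachable v w) ∧
      (w = u → ∀ t, (supportGraph G c').Adj u t → (supportGraph G c).Reachable v t) from H.1 hw
  clear hw
  rw [SimpleGraph.reachable_iff_reflTransGen] at h
  induction h with
  | refl => exact ⟨fun _ => .rfl, fun h => absurd h hv⟩
  | @tail y z _ hyz ih =>
    refine ⟨fun hz => ?_, ?_⟩
    · by_cases hy : y = u
      · subst hy; exact ih.2 rfl z hyz
      · refine (ih.1 hy).trans (SimpleGraph.Adj.reachable ⟨hyz.1, ?_, ?_⟩)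
        · rw [← hc y hy]; exact hyz.2.1
        · rw [← hc z hz]; exact hyz.2.2
    · rintro rfl t ht
      have hy : y ≠ z := hyz.1.ne
      by_cases hyt : y = t
      · subst hyt; exact ih.1 hy
      · refine (ih.1 hy).trans (SimpleGraph.Adj.reachable
          ⟨hu y t hyz.1.symm ht.1 hyt, ?_, ?_⟩)
        · rw [← hc y hy]; exact hyz.2.1
        · rw [← hc t ht.1.ne']; exact ht.2.2

lemma invariant_eq_of_add_single [Fintype V] {G : SimpleGraph V} {u : V}
    (hu : ∀ s t, G.Adj u s → G.Adj u t → s ≠ t → G.Adj s t) {m m' : V ⊕ V →₀ ℕ}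
    (h : invariant G (m + Finsupp.single (Sum.inl u) 1) =
      invariant G (m' + Finsupp.single (Sum.inl u) 1)) : invariant G m = invariant G m' := by
  classical
  have hdeg : ∀ m : V ⊕ V →₀ ℕ, vertexDegree (m + Finsupp.single (Sum.inl u) 1) =
      fun z => vertexDegree m z + if z = u then 1 else 0 := by
    intro m; funext z
    simp only [vertexDegree, Finsupp.add_apply, Finsupp.single_apply, Sum.inl.injEq,
      reduceCtorEq, if_false, eq_comm (a := u)]
    omega
  have hc1 := congrArg Prod.fst h
  have hc2 := congrArg Prod.snd h
  simp only [invariant] at hc1 hc2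
  rw [← hc1] at hc2
  set c' := vertexDegree (m + Finsupp.single (Sum.inl u) 1) with hc'
  have hc : vertexDegree m = vertexDegree m' := by
    funext z
    have := congrFun hc1 z
    rw [hc', hdeg, hdeg] at this
    simpa using this
  have hcc : ∀ z, z ≠ u → c' z = vertexDegree m z := fun z hz => by rw [hc', hdeg]; simp [hz]
  have hle : ∀ z, vertexDegree m z ≤ c' z := fun z => by rw [hc', hdeg]; simp
  have hmono : supportGraph G (vertexDegree m) ≤ supportGraph G c' := fun a b hab =>
    ⟨hab.1, fun h0 => hab.2.1 (Nat.le_zero.mp (h0 ▸ hle a)),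
      fun h0 => hab.2.2 (Nat.le_zero.mp (h0 ▸ hle b))⟩
  have hsum : ∀ v, ∑ w with (supportGraph G c').Reachable v w, m (Sum.inl w) =
      ∑ w with (supportGraph G c').Reachable v w, m' (Sum.inl w) := by
    intro v
    have := congrFun hc2 v
    simpa [componentDegree, Finset.sum_add_distrib] using this
  unfold invariant
  rw [← hc]
  refine Prod.ext rfl (funext fun v => ?_)
  change ∑ w with (supportGraph G (vertexDegree m)).Reachable v w, m (Sum.inl w) =
      ∑ w with (supportGraph G (vertexDegree m)).Reachable v w, m' (Sum.inl w)
  -- If `u` is new in the support, it was isolated before, and the other components change at most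
  -- by gaining `u`, where `m` and `m'` have exponent `0`. Otherwise the support graph is unchanged.
  by_cases hu0 : vertexDegree m u = 0
  · have hmu : m (Sum.inl u) = 0 := by unfold vertexDegree at hu0; omega
    have hmu' : m' (Sum.inl u) = 0 := by rw [hc] at hu0; unfold vertexDegree at hu0; omega
    have hiso : ∀ z, (supportGraph G (vertexDegree m)).Reachable u z → z = u := by
      intro z hz
      rw [SimpleGraph.reachable_iff_reflTransGen] at hz
      induction hz with
      | refl => rfl
      | tail _ h ih => rw [ih] at h; exact absurd hu0 h.2.1
    by_cases hv : v = u
    · subst hv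
      refine Finset.sum_congr rfl fun w hw => ?_
      rw [hiso w (Finset.mem_filter.mp hw).2, hmu, hmu']
    · have hconv : ∀ n : V ⊕ V →₀ ℕ, n (Sum.inl u) = 0 →
          ∑ w with (supportGraph G (vertexDegree m)).Reachable v w, n (Sum.inl w) =
          ∑ w with (supportGraph G c').Reachable v w, n (Sum.inl w) := by
        intro n hn
        refine Finset.sum_subset (fun w hw => ?_) fun w hw hw' => ?_
        · simp only [Finset.mem_filter, Finset.mem_univ, true_and] at hw ⊢
          exact hw.mono hmono
        · simp only [Finset.mem_filter, Finset.mem_univ, true_and] at hw hw'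
          by_cases hwu : w = u
          · rw [hwu, hn]
          · exact absurd (supportGraph_reachable_of_add hu hcc hv hwu hw) hw'
      rw [hconv m hmu, hconv m' hmu', hsum]
  · have : supportGraph G (vertexDegree m) = supportGraph G c' := by
      refine le_antisymm hmono fun a b hab => ⟨hab.1, ?_, ?_⟩
      · by_cases ha : a = u
        · rwa [ha]
        · rw [← hcc a ha]; exact hab.2.1
      · by_cases hb : b = u
        · rwa [hb]
        · rw [← hcc b hb]; exact hab.2.2
    rw [this]
    exact hsum v

/-- Multiplication by `x_u` acts injectively on the classes of monomials, so no cancellation arises.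
-/
theorem mem_of_X_inl_mul_mem [Finite V] {G : SimpleGraph V} {u : V}
    (hu : ∀ s t, G.Adj u s → G.Adj u t → s ≠ t → G.Adj s t) {g : MvPolynomial (V ⊕ V) K}
    (hg : X (Sum.inl u) * g ∈ binomialEdgeIdeal K G) : g ∈ binomialEdgeIdeal K G := by
  have := Fintype.ofFinite V
  rw [mem_binomialEdgeIdeal_iff] at hg ⊢
  refine classSum_eq_zero_of_factor
    (φ := fun m => invariant G (m + Finsupp.single (Sum.inl u) 1))
    (fun m m' => invariant_eq_of_add_single hu) ?_
  have : classSum K (fun m => invariant G (m + Finsupp.single (Sum.inl u) 1)) =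
      classSum K (invariant G) ∘ₗ LinearMap.mulLeft K (X (Sum.inl u)) := by
    refine linearMap_ext_monomial fun m => ?_
    rw [LinearMap.comp_apply, LinearMap.mulLeft_apply, X, monomial_mul, one_mul,
      classSum_monomial_one, classSum_monomial_one, add_comm m]
  rw [this]
  exact hg

/-- Exchanging `x` and `y` changes each generator by a sign; this carries results on `x_u` over to
`y_u`. -/
lemma rename_swap_mem {G : SimpleGraph V} {g : MvPolynomial (V ⊕ V) K}
    (hg : g ∈ binomialEdgeIdeal K G) : rename Sum.swap g ∈ binomialEdgeIdeal K G := by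
  suffices h : binomialEdgeIdeal K G ≤
      (binomialEdgeIdeal K G).comap (rename (Sum.swap : V ⊕ V → V ⊕ V)).toRingHom from h hg
  refine Ideal.span_le.mpr ?_
  rintro _ ⟨v, w, h, rfl⟩
  change rename Sum.swap _ ∈ binomialEdgeIdeal K G
  have := edgeBinomial_mem (K := K) h.symm
  simp only [map_sub, map_mul, rename_X, Sum.swap_inl, Sum.swap_inr]
  convert this using 1
  unfold edgeBinomial; ring

theorem mem_of_X_inr_mul_mem [Finite V] {G : SimpleGraph V} {u : V}
    (hu : ∀ s t, G.Adj u s → G.Adj u t → s ≠ t → G.Adj s t) {g : MvPolynomial (V ⊕ V) K}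
    (hg : X (Sum.inr u) * g ∈ binomialEdgeIdeal K G) : g ∈ binomialEdgeIdeal K G := by
  have h1 := rename_swap_mem hg
  rw [map_mul, rename_X, Sum.swap_inr] at h1
  have h2 := rename_swap_mem (mem_of_X_inl_mul_mem hu h1)
  rwa [rename_rename, Sum.swap_swap_eq, rename_id_apply] at h2

end FreeVertex

/-! ### Nonzerodivisors by leading forms -/

section NonZeroDivisor

variable {K : Type*} [Field K] {σ : Type*}

lemma weightedHomogeneousComponent_mul_right (w : σ → ℤ) {j : ℤ} {b : MvPolynomial σ K}
    (hb : IsWeightedHomogeneous w b j) (n : ℤ) (a : MvPolynomial σ K) :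
    weightedHomogeneousComponent w n (a * b) =
      weightedHomogeneousComponent w (n - j) a * b := by
  let := weightedGradedAlgebra K w
  have e : ∀ φ m, (DirectSum.decompose (weightedHomogeneousSubmodule K w) φ m :
      MvPolynomial σ K) = weightedHomogeneousComponent w m φ :=
    fun φ m => weightedDecomposition.decompose'_apply K w φ m
  have := DirectSum.coe_decompose_mul_add_of_right_mem (i := n - j)
    (weightedHomogeneousSubmodule K w) (a := a) (b := b) hb
  rwa [sub_add_cancel, e, e] at this

lemma exists_weightedHomogeneousComponent_eq_zero_of_lt (w : σ → ℤ) (g : MvPolynomial σ K) :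
    ∃ N, ∀ n, N < n → weightedHomogeneousComponent w n g = 0 := by
  obtain ⟨N, hN⟩ := (weightedHomogeneousComponent_finsupp (w := w) g).bddAbove
  refine ⟨N, fun n hn => ?_⟩
  by_contra h
  exact absurd (hN h) (not_le.mpr hn)

/-- The component of degree `n + 1` of `g (a + b)` is `g_n a + g_{n+1} b`. Descending in `n` from
above the top degree of `g`, each `g_n a`, hence each `g_n`, lies in `J`. -/
lemma mem_of_mul_add_mem {w : σ → ℤ} {J : Ideal (MvPolynomial σ K)}
    (hJ : ∀ g ∈ J, ∀ n, weightedHomogeneousComponent w n g ∈ J) {a b : MvPolynomial σ K}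
    (ha : IsWeightedHomogeneous w a 1) (hb : IsWeightedHomogeneous w b 0)
    (hnzd : ∀ g, g * a ∈ J → g ∈ J) {g : MvPolynomial σ K} (hg : g * (a + b) ∈ J) : g ∈ J := by
  obtain ⟨N, hN⟩ := exists_weightedHomogeneousComponent_eq_zero_of_lt w g
  have key : ∀ k : ℕ, ∀ n : ℤ, N - k < n → weightedHomogeneousComponent w n g ∈ J := by
    intro k
    induction k with
    | zero => intro n hn; rw [hN n (by simpa using hn)]; exact zero_mem _
    | succ k ih =>
      intro n hn
      have h1 := hJ _ hg (n + 1)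
      rw [mul_add, map_add, weightedHomogeneousComponent_mul_right w ha,
        weightedHomogeneousComponent_mul_right w hb, add_sub_cancel_right, sub_zero] at h1
      refine hnzd _ ((Submodule.add_mem_iff_left _ (Ideal.mul_mem_right _ _ (ih (n + 1) ?_))).mp h1)
      push_cast at hn
      omega
  rw [← sum_weightedHomogeneousComponent w g,
    finsum_eq_sum _ (weightedHomogeneousComponent_finsupp g)]
  refine Ideal.sum_mem _ fun n _ => key (N - n + 1).toNat n ?_
  omega

lemma weightedHomogeneousComponent_mem_span {w : σ → ℤ} {s : Set (MvPolynomial σ K)}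
    (hs : ∀ f ∈ s, ∃ n, IsWeightedHomogeneous w f n) {g : MvPolynomial σ K}
    (hg : g ∈ Ideal.span s) (n : ℤ) : weightedHomogeneousComponent w n g ∈ Ideal.span s := by
  let := weightedGradedAlgebra K w
  exact weightedHomogeneousComponent_mem_of_mem K w
    (Ideal.homogeneous_span _ _ fun f hf => hs f hf) hg n

theorem mem_of_mul_edgeBinomial_mem {V : Type*} [Finite V] {G : SimpleGraph V} {u v : V}
    (huv : ¬ G.Reachable u v)
    (hu : ∀ s t, G.Adj u s → G.Adj u t → s ≠ t → G.Adj s t)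
    (hv : ∀ s t, G.Adj v s → G.Adj v t → s ≠ t → G.Adj s t) {g : MvPolynomial (V ⊕ V) K}
    (hg : g * edgeBinomial K u v ∈ binomialEdgeIdeal K G) : g ∈ binomialEdgeIdeal K G := by
  classical
  -- Adjacent vertices get equal weights, so the generators are homogeneous; `v` is not reachable
  -- from `u`, which separates the two terms of the binomial.
  let w : V ⊕ V → ℤ := Sum.elim (fun z => if G.Reachable u z then 1 else 0) 0
  have hwu : w (Sum.inl u) = 1 := by simp [w]
  have hwv : w (Sum.inl v) = 0 := by simp [w, huv]
  have hwr : ∀ z, w (Sum.inr z) = 0 := fun z => rfl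
  have hX : ∀ s t, IsWeightedHomogeneous w (X s * X t : MvPolynomial (V ⊕ V) K) (w s + w t) :=
    fun s t => (isWeightedHomogeneous_X K w s).mul (isWeightedHomogeneous_X K w t)
  refine mem_of_mul_add_mem (w := w) (a := X (Sum.inl u) * X (Sum.inr v))
    (b := -(X (Sum.inl v) * X (Sum.inr u))) (fun g hg n => ?_) ?_ ?_ (fun g hg => ?_)
    (by rwa [← sub_eq_add_neg])
  · refine weightedHomogeneousComponent_mem_span ?_ hg n
    rintro _ ⟨s, t, hst, rfl⟩
    refine ⟨w (Sum.inl s), ?_⟩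
    have h1 := hX (Sum.inl s) (Sum.inr t)
    have h2 := hX (Sum.inl t) (Sum.inr s)
    have : w (Sum.inl t) = w (Sum.inl s) := by
      have : G.Reachable u t ↔ G.Reachable u s :=
        ⟨fun h => h.trans hst.symm.reachable, fun h => h.trans hst.reachable⟩
      simp [w, this]
    rw [hwr, add_zero] at h1 h2
    rw [this] at h2
    exact h1.sub h2
  · have := hX (Sum.inl u) (Sum.inr v)
    rwa [hwu, hwr, add_zero] at this
  · have := (hX (Sum.inl v) (Sum.inr u)).neg
    rwa [hwv, hwr, add_zero] at this
  · refine mem_of_X_inr_mul_mem hv (mem_of_X_inl_mul_mem hu ?_)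
    rwa [← mul_assoc, mul_comm]

end NonZeroDivisor

end BinomialEdgeIdeal

/-! ### Free cut edges -/

namespace SimpleGraph

variable {V : Type*}

/-- The edges `us` and `ut` extend to maximal cliques containing `u`; by uniqueness these coincide
and contain both `s` and `t`. -/
lemma IsFreeVertex.adj_of_adj [Finite V] {G : SimpleGraph V} {u : V} (h : G.IsFreeVertex u)
    (s t : V) (hs : G.Adj u s) (ht : G.Adj u t) (hst : s ≠ t) : G.Adj s t := by
  have key : ∀ s, G.Adj u s → ∃ F : Set V, (Maximal G.IsClique F ∧ u ∈ F) ∧ s ∈ F := by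
    intro s hs
    obtain ⟨F, hF, hmax⟩ := (Set.toFinite {F : Set V | G.IsClique F}).exists_le_maximal
      (a := {u, s}) (by simp [SimpleGraph.isClique_insert, hs])
    exact ⟨F, ⟨hmax, hF (by simp)⟩, hF (by simp)⟩
  obtain ⟨F, hF, hsF⟩ := key s hs
  obtain ⟨F', hF', htF⟩ := key t ht
  rw [h.unique hF' hF] at htF
  exact hF.1.1 hsF htF hst

/-- If the ends stayed connected, deleting the edge would not change reachability, nor the number of
components. -/
lemma IsCutEdge.not_reachable {G : SimpleGraph V} {u v : V} (h : G.IsCutEdge s(u, v)) :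
    ¬ (G.deleteEdges {s(u, v)}).Reachable u v := by
  intro huv
  have hR : G.Reachable = (G.deleteEdges {s(u, v)}).Reachable := by
    funext a b
    refine propext ⟨fun hab => ?_, fun hab => hab.mono (G.deleteEdges_le _)⟩
    rw [SimpleGraph.reachable_iff_reflTransGen] at hab
    induction hab with
    | refl => exact .rfl
    | @tail b c _ hbc ih =>
      refine ih.trans ?_
      by_cases he : s(b, c) = s(u, v)
      · rcases Sym2.eq_iff.mp he with ⟨rfl, rfl⟩ | ⟨rfl, rfl⟩
        · exact huv
        · exact huv.symm
      · exact SimpleGraph.Adj.reachable (by simp [hbc, he])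
  have := h.2
  unfold SimpleGraph.ConnectedComponent at this
  rw [hR] at this
  exact lt_irrefl _ this

end SimpleGraph

/-! ### The effect of deleting an edge on the ideal -/

namespace BinomialEdgeIdeal

open MvPolynomial GradedBetti

variable {K : Type*} [Field K] {V : Type*}

lemma binomialEdgeIdeal_deleteEdges_sup {G : SimpleGraph V} {u v : V} (h : G.Adj u v) :
    binomialEdgeIdeal K G = binomialEdgeIdeal K (G.deleteEdges {s(u, v)}) ⊔
      Ideal.span {edgeBinomial K u v} := by
  refine le_antisymm (Ideal.span_le.mpr ?_) (sup_le (Ideal.span_mono ?_) ?_)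
  · rintro _ ⟨a, b, hab, rfl⟩
    by_cases he : s(a, b) = s(u, v)
    · refine Ideal.mem_sup_right ?_
      rcases Sym2.eq_iff.mp he with ⟨rfl, rfl⟩ | ⟨rfl, rfl⟩
      · exact Ideal.subset_span rfl
      · rw [← neg_mem_iff, neg_sub]
        exact Ideal.subset_span rfl
    · exact Ideal.mem_sup_left (edgeBinomial_mem (by simp [hab, he]))
  · rintro _ ⟨a, b, hab, rfl⟩
    exact ⟨a, b, G.deleteEdges_le _ hab, rfl⟩
  · exact (Ideal.span_singleton_le_iff_mem _).mpr (edgeBinomial_mem h)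

lemma isWeightedHomogeneous_edgeBinomial (u v : V) :
    edgeBinomial K u v ∈ polyGrading (V ⊕ V) K 2 := by
  have hX : ∀ s t : V ⊕ V, IsWeightedHomogeneous (fun _ => (1 : ℤ))
      (X s * X t : MvPolynomial (V ⊕ V) K) 2 :=
    fun s t => (isWeightedHomogeneous_X K _ s).mul (isWeightedHomogeneous_X K _ t)
  exact (hX _ _).sub (hX _ _)

lemma binomialEdgeIdeal_le_constantCoeff_ker (G : SimpleGraph V) :
    binomialEdgeIdeal K G ≤ RingHom.ker (constantCoeff (R := K)) := by
  refine Ideal.span_le.mpr ?_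
  rintro _ ⟨a, b, _, rfl⟩
  simp

end BinomialEdgeIdeal

/-! ### Homogeneous maps between graded free modules -/

namespace GradedBetti

open MvPolynomial BinomialEdgeIdeal

variable {σ K : Type*} [Field K] {ι κ : Type*}

/-- The component of degree `j` of an element of the free module `⨁ S(-δ a)`. -/
noncomputable def freeComponent (δ : ι → ℤ) (j : ℤ) (x : ι → MvPolynomial σ K) :
    ι → MvPolynomial σ K :=
  fun a => weightedHomogeneousComponent (fun _ => (1 : ℤ)) (j - δ a) (x a)

lemma freeComponent_mem (δ : ι → ℤ) (j : ℤ) (x : ι → MvPolynomial σ K) (a : ι) :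
    freeComponent δ j x a ∈ polyGrading σ K (j - δ a) :=
  weightedHomogeneousComponent_mem _ _ _

lemma freeComponent_eq_self {j : ℤ} {x : ι → MvPolynomial σ K}
    (h : ∀ a, x a ∈ polyGrading σ K (j - δ a)) : freeComponent δ j x = x :=
  funext fun a => IsWeightedHomogeneous.weightedHomogeneousComponent_same (h a)

/-- A linear map `⨁ S(-δ b) → ⨁ S(-γ a)` that is homogeneous of degree `0`. -/
def IsHomogeneousMap [DecidableEq ι] (δ : ι → ℤ) (γ : κ → ℤ)
    (f : (ι → MvPolynomial σ K) →ₗ[MvPolynomial σ K] (κ → MvPolynomial σ K)) : Prop :=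
  ∀ b a, f (Pi.single b 1) a ∈ polyGrading σ K (δ b - γ a)

section

variable [Fintype ι] [DecidableEq ι] {δ : ι → ℤ} {γ : κ → ℤ}
  {f : (ι → MvPolynomial σ K) →ₗ[MvPolynomial σ K] (κ → MvPolynomial σ K)}

lemma linearMap_apply_eq_sum {M : Type*} [AddCommGroup M] [Module (MvPolynomial σ K) M]
    (f : (ι → MvPolynomial σ K) →ₗ[MvPolynomial σ K] M) (x : ι → MvPolynomial σ K) :
    f x = ∑ b, x b • f (Pi.single b 1) := by
  rw [LinearMap.pi_apply_eq_sum_univ f x]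
  refine Finset.sum_congr rfl fun b _ => ?_
  congr 2
  funext a
  simp [Pi.single_apply, eq_comm]

lemma linearMap_apply_apply
    (f : (ι → MvPolynomial σ K) →ₗ[MvPolynomial σ K] (κ → MvPolynomial σ K))
    (x : ι → MvPolynomial σ K) (a : κ) : f x a = ∑ b, x b * f (Pi.single b 1) a := by
  conv_lhs => rw [linearMap_apply_eq_sum f x]
  simp

lemma IsHomogeneousMap.map_freeComponent (hf : IsHomogeneousMap δ γ f) (j : ℤ)
    (x : ι → MvPolynomial σ K) : f (freeComponent δ j x) = freeComponent γ j (f x) := by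
  funext a
  rw [freeComponent, linearMap_apply_apply, linearMap_apply_apply f x, map_sum]
  refine Finset.sum_congr rfl fun b _ => ?_
  rw [weightedHomogeneousComponent_mul_right _ (hf b a), freeComponent]
  congr 3
  ring

/-- The linear map on a free module with prescribed values on the basis. -/
noncomputable def ofBasis {M : Type*} [AddCommGroup M] [Module (MvPolynomial σ K) M]
    (g : ι → M) : (ι → MvPolynomial σ K) →ₗ[MvPolynomial σ K] M :=
  Fintype.linearCombination _ g

lemma ofBasis_single {M : Type*} [AddCommGroup M] [Module (MvPolynomial σ K) M]
    (g : ι → M) (b : ι) : ofBasis (σ := σ) (K := K) g (Pi.single b 1) = g b := by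
  simp [ofBasis, Fintype.linearCombination_apply, Pi.single_apply]

lemma linearMap_ext_basis {M : Type*} [AddCommGroup M] [Module (MvPolynomial σ K) M]
    {f g : (ι → MvPolynomial σ K) →ₗ[MvPolynomial σ K] M}
    (h : ∀ b, f (Pi.single b 1) = g (Pi.single b 1)) : f = g := by
  ext x
  simpa using h x

/-- Lift each basis vector arbitrarily and keep the component of the right degree. -/
lemma IsHomogeneousMap.exists_lift {μ : Type*} [Fintype μ] [DecidableEq μ] {θ : μ → ℤ}
    {p : (μ → MvPolynomial σ K) →ₗ[MvPolynomial σ K] (κ → MvPolynomial σ K)}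
    (hf : IsHomogeneousMap δ γ f) (hp : IsHomogeneousMap θ γ p)
    (h : ∀ x, f x ∈ LinearMap.range p) :
    ∃ g : (ι → MvPolynomial σ K) →ₗ[MvPolynomial σ K] (μ → MvPolynomial σ K),
      IsHomogeneousMap δ θ g ∧ p ∘ₗ g = f := by
  choose y hy using fun b => h (Pi.single b 1)
  refine ⟨ofBasis fun b => freeComponent θ (δ b) (y b), fun b a => ?_, ?_⟩
  · rw [ofBasis_single]
    exact freeComponent_mem _ _ _ _
  · refine linearMap_ext_basis fun b => ?_
    rw [LinearMap.comp_apply, ofBasis_single, hp.map_freeComponent, hy]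
    exact freeComponent_eq_self (hf b)

lemma exists_lift {M N : Type*} [AddCommGroup M] [Module (MvPolynomial σ K) M]
    [AddCommGroup N] [Module (MvPolynomial σ K) N]
    (f : (ι → MvPolynomial σ K) →ₗ[MvPolynomial σ K] N) (p : M →ₗ[MvPolynomial σ K] N)
    (h : ∀ x, f x ∈ LinearMap.range p) :
    ∃ g : (ι → MvPolynomial σ K) →ₗ[MvPolynomial σ K] M, p ∘ₗ g = f := by
  choose y hy using fun b => h (Pi.single b 1)
  refine ⟨ofBasis y, linearMap_ext_basis fun b => ?_⟩
  rw [LinearMap.comp_apply, ofBasis_single, hy]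

end

lemma IsHomogeneousMap.comp {μ : Type*} [DecidableEq ι] {δ : ι → ℤ} {γ : κ → ℤ}
    {f : (ι → MvPolynomial σ K) →ₗ[MvPolynomial σ K] (κ → MvPolynomial σ K)} [Fintype κ] [DecidableEq κ] {θ : μ → ℤ}
    {g : (κ → MvPolynomial σ K) →ₗ[MvPolynomial σ K] (μ → MvPolynomial σ K)}
    (hg : IsHomogeneousMap γ θ g) (hf : IsHomogeneousMap δ γ f) :
    IsHomogeneousMap δ θ (g ∘ₗ f) := by
  intro b a
  rw [LinearMap.comp_apply, ← freeComponent_eq_self (hf b), hg.map_freeComponent]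
  exact weightedHomogeneousComponent_mem _ _ _

end GradedBetti

/-! ### Comparison of graded free resolutions -/

namespace GradedBetti

open MvPolynomial

variable {σ K : Type*} [Field K]

lemma constantCoeff_eq_zero_of_mem_polyGrading {j : ℤ} {p : MvPolynomial σ K}
    (hp : p ∈ polyGrading σ K j) (hj : j ≠ 0) : constantCoeff p = 0 :=
  IsWeightedHomogeneous.coeff_eq_zero hp 0 (by simpa using hj.symm)

lemma constantCoeff_map_eq_zero {ι κ : Type*} [Fintype ι] [DecidableEq ι]
    (f : (ι → MvPolynomial σ K) →ₗ[MvPolynomial σ K] (κ → MvPolynomial σ K))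
    {x : ι → MvPolynomial σ K} (hx : ∀ b, constantCoeff (x b) = 0) (a : κ) :
    constantCoeff (f x a) = 0 := by
  rw [linearMap_apply_apply, map_sum]
  exact Finset.sum_eq_zero fun b _ => by rw [map_mul, hx, zero_mul]

/-- The constant terms of `φ` vanish between basis vectors of different degrees. Hence `ψ φ ≡ 1`
modulo the variables restricts to a matrix identity `B A = 1` over `K` on the basis vectors of
degree `j`, and ranks give the inequality. -/
lemma card_degree_le {ι κ : Type*} [Fintype ι] [DecidableEq ι] [Fintype κ] [DecidableEq κ]
    {δ : ι → ℤ} {γ : κ → ℤ}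
    {φ : (ι → MvPolynomial σ K) →ₗ[MvPolynomial σ K] (κ → MvPolynomial σ K)}
    {ψ : (κ → MvPolynomial σ K) →ₗ[MvPolynomial σ K] (ι → MvPolynomial σ K)}
    (hφ : IsHomogeneousMap δ γ φ)
    (h : ∀ x a, constantCoeff (ψ (φ x) a) = constantCoeff (x a)) (j : ℤ) :
    Nat.card {b // δ b = j} ≤ Nat.card {a // γ a = j} := by
  let A : Matrix {a // γ a = j} {b // δ b = j} K :=
    fun a b => constantCoeff (φ (Pi.single b.1 1) a.1)
  let B : Matrix {b // δ b = j} {a // γ a = j} K :=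
    fun b a => constantCoeff (ψ (Pi.single a.1 1) b.1)
  have hBA : B * A = 1 := by
    ext b b'
    have h1 := h (Pi.single b'.1 1) b.1
    rw [linearMap_apply_apply ψ, map_sum] at h1
    have h2 : (B * A) b b' =
        ∑ a, constantCoeff (φ (Pi.single b'.1 1) a * ψ (Pi.single a 1) b.1) := by
      rw [Matrix.mul_apply, ← Finset.sum_subset (Finset.subset_univ {a | γ a = j}),
        Finset.sum_subtype _ (p := fun a => γ a = j) (by simp)]
      · exact Finset.sum_congr rfl fun a _ => by rw [map_mul, mul_comm]
      · intro a _ ha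
        have ha' : γ a ≠ j := by simpa using ha
        rw [map_mul, constantCoeff_eq_zero_of_mem_polyGrading (hφ b'.1 a), zero_mul]
        rw [b'.2, sub_ne_zero]
        exact ha'.symm
    rw [h2, h1, Matrix.one_apply, Pi.single_apply]
    by_cases hbb : b = b'
    · simp [hbb]
    · simp [hbb, Subtype.ext_iff.not.mp hbb]
  have := Matrix.rank_mul_le_left B A
  rw [hBA, Matrix.rank_one] at this
  simpa [Nat.card_eq_fintype_card] using this.trans (Matrix.rank_le_card_width B)

section

variable {r r' : ℕ → ℕ} {δ : ∀ i, Fin (r i) → ℤ} {δ' : ∀ i, Fin (r' i) → ℤ}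
  {d : ∀ i, (Fin (r (i + 1)) → MvPolynomial σ K) →ₗ[MvPolynomial σ K]
    (Fin (r i) → MvPolynomial σ K)}
  {d' : ∀ i, (Fin (r' (i + 1)) → MvPolynomial σ K) →ₗ[MvPolynomial σ K]
    (Fin (r' i) → MvPolynomial σ K)}

/-- There are homogeneous comparison maps between the modules with index `n + 1` of two
complexes, one way round homotopic to the identity, with a homotopy that vanishes modulo the
variables. -/
def Comparable (δ : ∀ i, Fin (r i) → ℤ) (δ' : ∀ i, Fin (r' i) → ℤ)
    (d : ∀ i, (Fin (r (i + 1)) → MvPolynomial σ K) →ₗ[MvPolynomial σ K]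
      (Fin (r i) → MvPolynomial σ K))
    (d' : ∀ i, (Fin (r' (i + 1)) → MvPolynomial σ K) →ₗ[MvPolynomial σ K]
      (Fin (r' i) → MvPolynomial σ K)) (n : ℕ) : Prop :=
  ∃ (φ : (Fin (r (n + 1)) → MvPolynomial σ K) →ₗ[MvPolynomial σ K]
      (Fin (r' (n + 1)) → MvPolynomial σ K))
    (ψ : (Fin (r' (n + 1)) → MvPolynomial σ K) →ₗ[MvPolynomial σ K]
      (Fin (r (n + 1)) → MvPolynomial σ K))
    (h : (Fin (r n) → MvPolynomial σ K) →ₗ[MvPolynomial σ K]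
      (Fin (r (n + 1)) → MvPolynomial σ K)),
    IsHomogeneousMap (δ (n + 1)) (δ' (n + 1)) φ ∧
    IsHomogeneousMap (δ' (n + 1)) (δ (n + 1)) ψ ∧
    (∀ x, d n x = 0 → d' n (φ x) = 0) ∧ (∀ x, d' n x = 0 → d n (ψ x) = 0) ∧
    (∀ x, d n (ψ (φ x) - x - h (d n x)) = 0) ∧
    ∀ x a, constantCoeff (h (d n x) a) = 0

lemma comparable_of_base (hd : ∀ i, IsHomogeneousMap (δ (i + 1)) (δ i) (d i))
    (hd' : ∀ i, IsHomogeneousMap (δ' (i + 1)) (δ' i) (d' i))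
    (hex : ∀ i, Function.Exact (d (i + 1)) (d i))
    (hex' : ∀ i, Function.Exact (d' (i + 1)) (d' i))
    (hmin : ∀ i x a, constantCoeff (d (i + 1) x a) = 0)
    (h0 : Comparable δ δ' d d' 0) (n : ℕ) : Comparable δ δ' d d' n := by
  induction n with
  | zero => exact h0
  | succ n ih =>
    obtain ⟨φ, ψ, h, hφ, hψ, hφd, hψd, hh, hh0⟩ := ih
    obtain ⟨φ', hφ', hφφ⟩ := (hφ.comp (hd (n + 1))).exists_lift (hd' (n + 1)) fun x =>
      (hex' n _).mp (hφd _ ((hex n).apply_apply_eq_zero x))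
    obtain ⟨ψ', hψ', hψψ⟩ := (hψ.comp (hd' (n + 1))).exists_lift (hd (n + 1)) fun x =>
      (hex n _).mp (hψd _ ((hex' n).apply_apply_eq_zero x))
    -- The next homotopy need not be homogeneous: it only enters through `h' ∘ d`, which vanishes
    -- modulo the variables because `d` does.
    obtain ⟨h', hh'⟩ := exists_lift (ψ ∘ₗ φ - LinearMap.id - h ∘ₗ d n) (d (n + 1)) fun x =>
      (hex n _).mp (hh x)
    have e1 : ∀ x, d' (n + 1) (φ' x) = φ (d (n + 1) x) := LinearMap.congr_fun hφφ
    have e2 : ∀ x, d (n + 1) (ψ' x) = ψ (d' (n + 1) x) := LinearMap.congr_fun hψψ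
    have e3 : ∀ x, d (n + 1) (h' x) = ψ (φ x) - x - h (d n x) := LinearMap.congr_fun hh'
    refine ⟨φ', ψ', h', hφ', hψ', fun x hx => ?_, fun x hx => ?_, fun x => ?_, fun x a => ?_⟩
    · rw [e1, hx, map_zero]
    · rw [e2, hx, map_zero]
    · rw [map_sub, map_sub, e2, e1, e3, (hex n).apply_apply_eq_zero, map_zero, sub_zero, sub_self]
    · exact constantCoeff_map_eq_zero h' (hmin n x) a

/-- The defect `ψ φ - 1 - h d` has values in the image of the next differential, so by minimality `ψ
φ` is the identity modulo the variables. -/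
lemma Comparable.card_le {n : ℕ} (h : Comparable δ δ' d d' n)
    (hex : ∀ i, Function.Exact (d (i + 1)) (d i))
    (hmin : ∀ i x a, constantCoeff (d (i + 1) x a) = 0) (j : ℤ) :
    Nat.card {b // δ (n + 1) b = j} ≤ Nat.card {a // δ' (n + 1) a = j} := by
  obtain ⟨φ, ψ, h, hφ, -, -, -, hh, hh0⟩ := h
  refine card_degree_le hφ (ψ := ψ) (fun x a => ?_) j
  obtain ⟨y, hy⟩ := (hex n _).mp (hh x)
  have := congrArg constantCoeff (congrFun hy a)
  simp only [Pi.sub_apply, map_sub, hmin, hh0, sub_zero] at this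
  exact (sub_eq_zero.mp this.symm)

end

/-! ### The augmented complex of a resolution of an ideal -/

namespace GradedFreeResolution

variable {J : Ideal (MvPolynomial σ K)} (F : GradedFreeResolution (σ := σ) (idealGrading J))

/-- The ranks of the augmented complex `⋯ → F₁ → F₀ → S`. -/
def augRank : ℕ → ℕ
  | 0 => 1
  | i + 1 => F.rank i

instance : Unique (Fin (F.augRank 0)) := inferInstanceAs (Unique (Fin 1))

/-- The degrees of the basis vectors of the augmented complex. -/
def augDeg : (i : ℕ) → Fin (F.augRank i) → ℤ
  | 0 => fun _ => 0
  | i + 1 => F.deg i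

/-- The differentials of the augmented complex. -/
noncomputable def augD : (i : ℕ) →
    (Fin (F.augRank (i + 1)) → MvPolynomial σ K) →ₗ[MvPolynomial σ K]
      (Fin (F.augRank i) → MvPolynomial σ K)
  | 0 => LinearMap.pi fun _ => J.subtype ∘ₗ F.ε
  | i + 1 => F.d i

lemma augD_homogeneous : ∀ i, IsHomogeneousMap (F.augDeg (i + 1)) (F.augDeg i) (F.augD i)
  | 0 => fun b a => by simpa [augDeg] using! F.ε_homogeneous b
  | i + 1 => F.d_homogeneous i

lemma augD_zero_apply (x : Fin (F.rank 0) → MvPolynomial σ K) (a) :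
    F.augD 0 x a = (F.ε x : MvPolynomial σ K) := rfl

lemma augD_zero_eq_zero_iff (x : Fin (F.rank 0) → MvPolynomial σ K) :
    F.augD 0 x = 0 ↔ F.ε x = 0 :=
  ⟨fun h => Subtype.ext (congrFun h default), fun h => funext fun a => by
    rw [augD_zero_apply, h]; rfl⟩

lemma augD_exact : ∀ i, Function.Exact (F.augD (i + 1)) (F.augD i)
  | 0 => fun x => (F.augD_zero_eq_zero_iff x).trans (F.exact_ε x)
  | i + 1 => F.exact_d i

lemma mem_range_augD_zero (x : Fin (F.augRank 0) → MvPolynomial σ K) :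
    x ∈ LinearMap.range (F.augD 0) ↔ x default ∈ J := by
  constructor
  · rintro ⟨y, rfl⟩
    exact (F.ε y).2
  · intro h
    obtain ⟨y, hy⟩ := F.surjective_ε ⟨x default, h⟩
    refine ⟨y, funext fun a => ?_⟩
    rw [augD_zero_apply, hy, Subsingleton.elim a default]

/-- Both augmented complexes map onto the same ideal `J` in `S`. Lifting the identity of `S` starts
the comparison, with zero homotopy. -/
theorem IsMinimal.card_le {F F' : GradedFreeResolution (σ := σ) (idealGrading J)}
    (hF : F.IsMinimal) (n : ℕ) (j : ℤ) :
    Nat.card {b // F.deg n b = j} ≤ Nat.card {a // F'.deg n a = j} := by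
  have hmin : ∀ i x a, constantCoeff (F.augD (i + 1) x a) = 0 := hF
  refine Comparable.card_le (comparable_of_base F.augD_homogeneous F'.augD_homogeneous
    F.augD_exact F'.augD_exact hmin ?_ n) F.augD_exact hmin j
  have key : ∀ F F' : GradedFreeResolution (σ := σ) (idealGrading J),
      ∃ φ : (Fin (F.augRank 1) → MvPolynomial σ K) →ₗ[MvPolynomial σ K]
        (Fin (F'.augRank 1) → MvPolynomial σ K),
        IsHomogeneousMap (F.augDeg 1) (F'.augDeg 1) φ ∧ F'.augD 0 ∘ₗ φ = F.augD 0 :=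
    fun F F' => (F.augD_homogeneous 0).exists_lift (F'.augD_homogeneous 0) fun x =>
      (F'.mem_range_augD_zero _).mpr ((F.mem_range_augD_zero _).mp ⟨x, rfl⟩)
  obtain ⟨φ, hφ, h1⟩ := key F F'
  obtain ⟨ψ, hψ, h2⟩ := key F' F
  have e1 : ∀ x, F'.augD 0 (φ x) = F.augD 0 x := LinearMap.congr_fun h1
  have e2 : ∀ x, F.augD 0 (ψ x) = F'.augD 0 x := LinearMap.congr_fun h2
  refine ⟨φ, ψ, 0, hφ, hψ, fun x hx => (e1 x).trans hx, fun x hx => (e2 x).trans hx,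
    fun x => ?_, fun x a => by simp⟩
  rw [LinearMap.zero_apply, sub_zero, map_sub, e2, e1, sub_self]

theorem IsMinimal.betti_eq {F : GradedFreeResolution (σ := σ) (idealGrading J)}
    (hF : F.IsMinimal) (n : ℕ) (j : ℤ) :
    betti σ (idealGrading J) n j = Nat.card {b // F.deg n b = j} := by
  have h : ∃ F : GradedFreeResolution (σ := σ) (idealGrading J), F.IsMinimal := ⟨F, hF⟩
  rw [betti, dif_pos h]
  exact le_antisymm (h.choose_spec.card_le n j) (hF.card_le n j)

end GradedFreeResolution

end GradedBetti

/-! ### Existence of minimal graded free resolutions -/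

namespace GradedBetti

open MvPolynomial

variable {σ K : Type*} [Field K]

lemma weight_one_eq_zero_iff (m : σ →₀ ℕ) : Finsupp.weight (fun _ : σ => (1 : ℤ)) m = 0 ↔ m = 0 := by
  constructor
  · intro h
    have h' : ((∑ a ∈ m.support, m a : ℕ) : ℤ) = 0 := by
      simpa [Finsupp.weight_apply, Finsupp.sum] using h
    ext a
    by_contra ha
    have := Finset.sum_eq_zero_iff.mp (Nat.cast_eq_zero.mp h') a (by simpa using ha)
    exact ha (by simpa using this)
  · rintro rfl; simp

lemma weightedHomogeneousComponent_one_zero (p : MvPolynomial σ K) :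
    weightedHomogeneousComponent (fun _ : σ => (1 : ℤ)) 0 p = C (constantCoeff p) := by
  classical
  ext m
  rw [coeff_weightedHomogeneousComponent, coeff_C, constantCoeff_eq]
  by_cases hm : m = 0
  · simp [hm]
  · rw [if_neg (by rwa [weight_one_eq_zero_iff]), if_neg (Ne.symm hm)]

lemma exists_sum_freeComponent {ι : Type*} [Finite ι] (δ : ι → ℤ) (x : ι → MvPolynomial σ K) :
    ∃ F : Finset ℤ, x = ∑ j ∈ F, freeComponent δ j x := by
  classical
  have := Fintype.ofFinite ι
  have hfin : ∀ a, (Function.support fun j => freeComponent δ j x a).Finite := by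
    intro a
    have h := weightedHomogeneousComponent_finsupp (w := fun _ : σ => (1 : ℤ)) (x a)
    exact h.preimage (f := fun j => j - δ a) (fun i _ j _ h => by simpa using h)
  refine ⟨Finset.univ.biUnion fun a => (hfin a).toFinset, funext fun a => ?_⟩
  rw [Finset.sum_apply, ← finsum_eq_sum_of_support_subset]
  · conv_lhs => rw [← sum_weightedHomogeneousComponent (fun _ : σ => (1 : ℤ)) (x a)]
    exact (finsum_comp_equiv (Equiv.subRight (δ a))
      (f := fun m => weightedHomogeneousComponent (fun _ : σ => (1 : ℤ)) m (x a))).symm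
  · intro j hj
    simp only [Finset.coe_biUnion, Set.mem_iUnion]
    exact ⟨a, by simp, by simpa using hj⟩

lemma exists_homogeneous_generators [Finite σ] {ι : Type*} [Finite ι] (δ : ι → ℤ)
    (N : Submodule (MvPolynomial σ K) (ι → MvPolynomial σ K))
    (hN : ∀ x ∈ N, ∀ j, freeComponent δ j x ∈ N) :
    ∃ (k : ℕ) (v : Fin k → ι → MvPolynomial σ K) (θ : Fin k → ℤ),
      (∀ b a, v b a ∈ polyGrading σ K (θ b - δ a)) ∧
        Submodule.span (MvPolynomial σ K) (Set.range v) = N := by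
  classical
  let T : Set (ι → MvPolynomial σ K) := {x | x ∈ N ∧ ∃ j, ∀ a, x a ∈ polyGrading σ K (j - δ a)}
  have hT : Submodule.span (MvPolynomial σ K) T = N := by
    refine le_antisymm (Submodule.span_le.mpr fun x hx => hx.1) fun x hx => ?_
    obtain ⟨F, hF⟩ := exists_sum_freeComponent δ x
    rw [hF]
    exact Submodule.sum_mem _ fun j _ => Submodule.subset_span
      ⟨hN x hx j, j, fun a => freeComponent_mem δ j x a⟩
  obtain ⟨s, hsT, hs⟩ := Submodule.fg_span_iff_fg_span_finset_subset T |>.mp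
    (IsNoetherian.noetherian (Submodule.span (MvPolynomial σ K) T))
  choose θ hθ using fun x : s => (hsT x.2).2
  let e := Fintype.equivFin s
  refine ⟨Fintype.card s, fun b => (e.symm b : ι → MvPolynomial σ K), fun b => θ (e.symm b),
    fun b a => hθ _ a, ?_⟩
  rw [← hT, hs]
  congr 1
  ext x
  constructor
  · rintro ⟨b, rfl⟩; exact (e.symm b).2
  · intro hx; exact ⟨e ⟨x, hx⟩, by simp⟩

/-- Graded Nakayama: take the least possible number of homogeneous generators. A relation with a
nonzero constant term at one generator would make that generator redundant. -/
lemma exists_minimal_cover [Finite σ] {ι : Type*} [Finite ι] (δ : ι → ℤ)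
    (N : Submodule (MvPolynomial σ K) (ι → MvPolynomial σ K))
    (hN : ∀ x ∈ N, ∀ j, freeComponent δ j x ∈ N) :
    ∃ (k : ℕ) (θ : Fin k → ℤ)
      (g : (Fin k → MvPolynomial σ K) →ₗ[MvPolynomial σ K] (ι → MvPolynomial σ K)),
      IsHomogeneousMap θ δ g ∧ LinearMap.range g = N ∧
        ∀ x, g x = 0 → ∀ b, constantCoeff (x b) = 0 := by
  classical
  have hex := exists_homogeneous_generators δ N hN
  obtain ⟨v, θ, hv, hspan⟩ := Nat.find_spec hex
  have hmin := fun m => Nat.find_min hex (m := m)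
  generalize Nat.find hex = k at v θ hv hspan hmin
  have hg : IsHomogeneousMap θ δ (ofBasis v) := fun b a => by rw [ofBasis_single]; exact hv b a
  refine ⟨k, θ, ofBasis v, hg, ?_, fun x hx b₀ => ?_⟩
  · rw [← hspan]; exact Fintype.range_linearCombination _ v
  · by_contra hb
    obtain _ | k := k
    · exact b₀.elim0
    refine hmin k (Nat.lt_succ_self k) ⟨v ∘ b₀.succAbove, θ ∘ b₀.succAbove,
      fun b a => hv _ a, ?_⟩
    rw [← hspan]
    refine le_antisymm (Submodule.span_mono (Set.range_comp_subset_range _ _))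
      (Submodule.span_le.mpr ?_)
    have hmem : ∀ b, v (b₀.succAbove b) ∈
        Submodule.span (MvPolynomial σ K) (Set.range (v ∘ b₀.succAbove)) :=
      fun b => Submodule.subset_span ⟨b, rfl⟩
    -- In the part of the relation of degree `θ b₀`, the coefficient at `b₀` is a nonzero scalar and
    -- can be inverted.
    have h1 := hg.map_freeComponent (θ b₀) x
    have h0 : freeComponent δ (θ b₀) (0 : ι → MvPolynomial σ K) = 0 := by
      funext a; simp [freeComponent]
    rw [hx, h0, ofBasis, Fintype.linearCombination_apply, Fin.sum_univ_succAbove _ b₀] at h1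
    have h2 : freeComponent θ (θ b₀) x b₀ = C (constantCoeff (x b₀)) := by
      rw [freeComponent, sub_self, weightedHomogeneousComponent_one_zero]
    rw [h2] at h1
    have h3 : v b₀ ∈ Submodule.span (MvPolynomial σ K) (Set.range (v ∘ b₀.succAbove)) := by
      have : v b₀ = (C (constantCoeff (x b₀))⁻¹ : MvPolynomial σ K) •
          ((C (constantCoeff (x b₀)) : MvPolynomial σ K) • v b₀) := by
        rw [smul_smul, ← C_mul, inv_mul_cancel₀ hb, C_1, one_smul]
      rw [this, eq_neg_of_add_eq_zero_left h1]
      exact Submodule.smul_mem _ _ (neg_mem (Submodule.sum_mem _ fun b _ =>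
        Submodule.smul_mem _ _ (hmem b)))
    rintro _ ⟨b, rfl⟩
    by_cases hbb : b = b₀
    · rw [hbb]; exact h3
    · obtain ⟨b', rfl⟩ := Fin.exists_succAbove_eq hbb
      exact hmem b'

/-- A homogeneous map between graded free modules of finite rank. -/
structure GradedMap (σ K : Type*) [Field K] where
  /-- the rank of the source -/
  src : ℕ
  /-- the rank of the target -/
  tgt : ℕ
  /-- the degrees of the basis vectors of the source -/
  srcDeg : Fin src → ℤ
  /-- the degrees of the basis vectors of the target -/
  tgtDeg : Fin tgt → ℤ
  /-- the underlying linear map -/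
  map : (Fin src → MvPolynomial σ K) →ₗ[MvPolynomial σ K] (Fin tgt → MvPolynomial σ K)
  homogeneous : IsHomogeneousMap srcDeg tgtDeg map

lemma GradedMap.exists_cover_ker [Finite σ] (f : GradedMap σ K) :
    ∃ (k : ℕ) (θ : Fin k → ℤ)
      (g : (Fin k → MvPolynomial σ K) →ₗ[MvPolynomial σ K] (Fin f.src → MvPolynomial σ K)),
      IsHomogeneousMap θ f.srcDeg g ∧ LinearMap.range g = LinearMap.ker f.map ∧
        ∀ x, g x = 0 → ∀ b, constantCoeff (x b) = 0 :=
  exists_minimal_cover f.srcDeg (LinearMap.ker f.map) fun x hx j => by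
    rw [LinearMap.mem_ker] at hx ⊢
    rw [f.homogeneous.map_freeComponent, hx]
    funext a
    simp [freeComponent]

/-- A minimal cover of the kernel of a homogeneous map. -/
noncomputable def GradedMap.next [Finite σ] (f : GradedMap σ K) : GradedMap σ K where
  src := f.exists_cover_ker.choose
  tgt := f.src
  srcDeg := f.exists_cover_ker.choose_spec.choose
  tgtDeg := f.srcDeg
  map := f.exists_cover_ker.choose_spec.choose_spec.choose
  homogeneous := f.exists_cover_ker.choose_spec.choose_spec.choose_spec.1

lemma GradedMap.range_next [Finite σ] (f : GradedMap σ K) :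
    LinearMap.range f.next.map = LinearMap.ker f.map :=
  f.exists_cover_ker.choose_spec.choose_spec.choose_spec.2.1

lemma GradedMap.next_minimal [Finite σ] (f : GradedMap σ K) (x) (hx : f.next.map x = 0) (b) :
    constantCoeff (x b) = 0 :=
  f.exists_cover_ker.choose_spec.choose_spec.choose_spec.2.2 x hx b

/-- The iterated minimal covers of kernels, starting from a given map. -/
noncomputable def GradedMap.iterate [Finite σ] (f : GradedMap σ K) : ℕ → GradedMap σ K
  | 0 => f
  | i + 1 => (f.iterate i).next

theorem exists_isMinimal [Finite σ] {J : Ideal (MvPolynomial σ K)}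
    (hJ : ∀ g ∈ J, ∀ n, weightedHomogeneousComponent (fun _ : σ => (1 : ℤ)) n g ∈ J) :
    ∃ F : GradedFreeResolution (σ := σ) (idealGrading J), F.IsMinimal := by
  -- `J` is viewed inside the free module of rank one, so that the cover of `J` and those of the
  -- later kernels come from one lemma.
  obtain ⟨k, θ, g, hg, hrange, hgmin⟩ := exists_minimal_cover (ι := Fin 1) (fun _ => 0)
    (Submodule.comap (LinearMap.proj (R := MvPolynomial σ K) (φ := fun _ : Fin 1 => MvPolynomial σ K) 0) J)
    fun x hx j => by
      rw [Submodule.mem_comap] at hx ⊢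
      exact hJ _ hx _
  have hmem : ∀ x, g x 0 ∈ J := fun x => by
    have : g x ∈ LinearMap.range g := ⟨x, rfl⟩
    rwa [hrange] at this
  let f : GradedMap σ K := ⟨k, 1, θ, fun _ => 0, g, hg⟩
  have hmin : ∀ i x b, (f.iterate i).map x = 0 → constantCoeff (x b) = 0 := by
    intro i x b hx
    cases i with
    | zero => exact hgmin x hx b
    | succ i => exact (f.iterate i).next_minimal x hx b
  have hexact : ∀ i, Function.Exact (f.iterate i).next.map (f.iterate i).map := fun i =>
    LinearMap.exact_iff.mpr (f.iterate i).range_next.symm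
  let ε : (Fin k → MvPolynomial σ K) →ₗ[MvPolynomial σ K] J :=
    LinearMap.codRestrict J (LinearMap.proj 0 ∘ₗ g) hmem
  have hε : ∀ x, ε x = 0 ↔ g x = 0 := fun x =>
    ⟨fun h => funext fun a => by
      rw [Subsingleton.elim a 0]; exact congrArg Subtype.val h,
      fun h => Subtype.ext (congrFun h 0)⟩
  refine ⟨{ rank := fun i => (f.iterate i).src
            deg := fun i => (f.iterate i).srcDeg
            d := fun i => (f.iterate i).next.map
            ε := ε
            d_homogeneous := fun i => (f.iterate i).next.homogeneous
            ε_homogeneous := fun a => ?_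
            exact_d := fun i => hexact (i + 1)
            exact_ε := fun x => (hε x).trans (hexact 0 x)
            surjective_ε := fun y => ?_ }, fun i x a => ?_⟩
  · have := hg a 0
    rwa [sub_zero] at this
  · have : (fun _ => y : Fin 1 → MvPolynomial σ K) ∈ LinearMap.range g := by
      rw [hrange]; exact y.2
    obtain ⟨x, hx⟩ := this
    exact ⟨x, Subtype.ext (congrFun hx 0)⟩
  · exact hmin i _ a ((hexact i).apply_apply_eq_zero x)

end GradedBetti

/-! ### The mapping cone of multiplication by a nonzerodivisor -/

namespace GradedBetti

open MvPolynomial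

variable {σ K : Type*} [Field K]

section Sum

variable {m n p q : ℕ}

/-- `S^{m+n} = S^m × S^n`. -/
noncomputable def splitEquiv (σ K : Type*) [Field K] (m n : ℕ) :
    (Fin (m + n) → MvPolynomial σ K) ≃ₗ[MvPolynomial σ K]
      (Fin m → MvPolynomial σ K) × (Fin n → MvPolynomial σ K) :=
  LinearEquiv.funCongrLeft _ _ finSumFinEquiv ≪≫ₗ LinearEquiv.sumArrowLequivProdArrow _ _ _ _

lemma splitEquiv_fst_apply (x : Fin (m + n) → MvPolynomial σ K) (a : Fin m) :
    (splitEquiv σ K m n x).1 a = x (Fin.castAdd n a) := rfl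

lemma splitEquiv_snd_apply (x : Fin (m + n) → MvPolynomial σ K) (a : Fin n) :
    (splitEquiv σ K m n x).2 a = x (Fin.natAdd m a) := rfl

lemma splitEquiv_single_castAdd (a : Fin m) :
    splitEquiv σ K m n (Pi.single (Fin.castAdd n a) 1) = (Pi.single a 1, 0) := by
  refine Prod.ext (funext fun b => ?_) (funext fun b => ?_)
  · rw [splitEquiv_fst_apply]; simp [Pi.single_apply]
  · rw [splitEquiv_snd_apply, Pi.single_apply, if_neg]
    · rfl
    · intro h
      have := congrArg Fin.val h
      simp only [Fin.val_natAdd, Fin.val_castAdd] at this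
      omega

lemma splitEquiv_single_natAdd (a : Fin n) :
    splitEquiv σ K m n (Pi.single (Fin.natAdd m a) 1) = (0, Pi.single a 1) := by
  refine Prod.ext (funext fun b => ?_) (funext fun b => ?_)
  · rw [splitEquiv_fst_apply, Pi.single_apply, if_neg]
    · rfl
    · intro h
      have := congrArg Fin.val h
      simp only [Fin.val_natAdd, Fin.val_castAdd] at this
      omega
  · rw [splitEquiv_snd_apply]; simp [Pi.single_apply]

lemma card_append_degree (δ : Fin m → ℤ) (γ : Fin n → ℤ) (j : ℤ) :
    Nat.card {a // Fin.append δ γ a = j} =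
      Nat.card {a // δ a = j} + Nat.card {a // γ a = j} := by
  classical
  simp only [Nat.card_eq_fintype_card, Fintype.card_subtype, Finset.card_filter,
    Fin.sum_univ_add, Fin.append_left, Fin.append_right]

end Sum

namespace GradedFreeResolution

variable {J : Ideal (MvPolynomial σ K)} (F : GradedFreeResolution (σ := σ) (idealGrading J))

/-- The differentials `(x, z) ↦ (∂x + f z, -∂z)` of the cone of multiplication by `f` on the
augmented complex. -/
noncomputable def coneD (f : MvPolynomial σ K) (i : ℕ) :
    (Fin (F.augRank (i + 2) + F.augRank (i + 1)) → MvPolynomial σ K) →ₗ[MvPolynomial σ K]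
      (Fin (F.augRank (i + 1) + F.augRank i) → MvPolynomial σ K) :=
  (splitEquiv σ K _ _).symm.toLinearMap ∘ₗ
    (LinearMap.prod
      (F.augD (i + 1) ∘ₗ LinearMap.fst _ _ _ + f • LinearMap.snd _ _ _)
      (-(F.augD i ∘ₗ LinearMap.snd _ _ _))) ∘ₗ (splitEquiv σ K _ _).toLinearMap

lemma splitEquiv_coneD (f : MvPolynomial σ K) (i : ℕ) (x) :
    splitEquiv σ K _ _ (F.coneD f i x) =
      (F.augD (i + 1) (splitEquiv σ K _ _ x).1 + f • (splitEquiv σ K _ _ x).2,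
        -F.augD i (splitEquiv σ K _ _ x).2) := by
  simp [coneD]

lemma coneD_castAdd (f : MvPolynomial σ K) (i : ℕ) (x) (a : Fin (F.augRank (i + 1))) :
    F.coneD f i x (Fin.castAdd _ a) =
      F.augD (i + 1) (splitEquiv σ K _ _ x).1 a + f * (splitEquiv σ K _ _ x).2 a :=
  (splitEquiv_fst_apply _ a).symm.trans (by rw [splitEquiv_coneD]; simp)

lemma coneD_natAdd (f : MvPolynomial σ K) (i : ℕ) (x) (a : Fin (F.augRank i)) :
    F.coneD f i x (Fin.natAdd _ a) = -F.augD i (splitEquiv σ K _ _ x).2 a :=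
  (splitEquiv_snd_apply _ a).symm.trans (by rw [splitEquiv_coneD]; simp)

/-- The degrees of the basis vectors of the cone. -/
def coneDeg (n : ℤ) (i : ℕ) : Fin (F.augRank (i + 1) + F.augRank i) → ℤ :=
  Fin.append (F.augDeg (i + 1)) (fun a => F.augDeg i a + n)

lemma coneD_homogeneous {f : MvPolynomial σ K} {n : ℤ} (hf : f ∈ polyGrading σ K n) (i : ℕ) :
    IsHomogeneousMap (F.coneDeg n (i + 1)) (F.coneDeg n i) (F.coneD f i) := by
  intro b a
  refine Fin.addCases (fun b => ?_) (fun b => ?_) b <;>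
    refine Fin.addCases (fun a => ?_) (fun a => ?_) a
  · rw [coneD_castAdd, splitEquiv_single_castAdd]
    simpa [coneDeg] using F.augD_homogeneous (i + 1) b a
  · rw [coneD_natAdd, splitEquiv_single_castAdd]
    simp
  · rw [coneD_castAdd, splitEquiv_single_natAdd]
    by_cases hab : a = b
    · subst hab; simpa [coneDeg] using hf
    · simp [hab]
  · rw [coneD_natAdd, splitEquiv_single_natAdd]
    have := neg_mem (F.augD_homogeneous i b a)
    simpa [coneDeg] using this

lemma coneD_exact (f : MvPolynomial σ K) (i : ℕ) :
    Function.Exact (F.coneD f (i + 1)) (F.coneD f i) := by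
  intro y
  constructor
  · intro hy
    have h := F.splitEquiv_coneD f i y
    rw [hy, map_zero] at h
    obtain ⟨h1, h2⟩ := Prod.ext_iff.mp h
    -- For a cycle `(x, z)`, write `z = ∂w`; then `x + f w` is a cycle, equal to some `∂z'`, and
    -- `(z', -w)` is the required preimage.
    obtain ⟨w, hw⟩ := (F.augD_exact i _).mp (neg_eq_zero.mp h2.symm)
    have h3 : F.augD (i + 1) ((splitEquiv σ K _ _ y).1 + f • w) = 0 := by
      rw [map_add, map_smul, hw]; exact h1.symm
    obtain ⟨z, hz⟩ := (F.augD_exact (i + 1) _).mp h3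
    refine ⟨(splitEquiv σ K _ _).symm (z, -w), (splitEquiv σ K _ _).injective ?_⟩
    rw [splitEquiv_coneD, LinearEquiv.apply_symm_apply]
    refine Prod.ext ?_ ?_
    · simp [hz]
    · simp [hw]
  · rintro ⟨x, rfl⟩
    refine (splitEquiv σ K _ _).injective ?_
    rw [splitEquiv_coneD, splitEquiv_coneD, map_zero]
    refine Prod.ext ?_ ?_
    · simp [(F.augD_exact (i + 1)).apply_apply_eq_zero]
    · simp [(F.augD_exact i).apply_apply_eq_zero]

/-- The augmentation `(x, z) ↦ ∂x + f z` of the cone, with values in `J + (f)`. -/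
noncomputable def coneε {J' : Ideal (MvPolynomial σ K)} (f : MvPolynomial σ K)
    (hJ' : J' = J ⊔ Ideal.span {f}) :
    (Fin (F.augRank 1 + F.augRank 0) → MvPolynomial σ K) →ₗ[MvPolynomial σ K] J' :=
  LinearMap.codRestrict J'
    (LinearMap.proj default ∘ₗ
      (F.augD 0 ∘ₗ LinearMap.fst _ _ _ + f • LinearMap.snd _ _ _) ∘ₗ
        (splitEquiv σ K _ _).toLinearMap)
    fun x => by
      rw [hJ']
      exact add_mem (Ideal.mem_sup_left ((F.mem_range_augD_zero _).mp ⟨_, rfl⟩))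
        (Ideal.mem_sup_right (Ideal.mul_mem_right _ _ (Ideal.subset_span rfl)))

lemma coe_coneε {J' : Ideal (MvPolynomial σ K)} (f : MvPolynomial σ K)
    (hJ' : J' = J ⊔ Ideal.span {f}) (x) :
    (F.coneε f hJ' x : MvPolynomial σ K) = F.augD 0 (splitEquiv σ K _ _ x).1 default +
      f * (splitEquiv σ K _ _ x).2 default := rfl

/-- The only place in the cone where regularity of `f` enters: `∂x + f z = 0` gives `f z ∈ J`, hence
`z ∈ J`, and `z` is a boundary of the augmented complex. -/
lemma coneε_exact {J' : Ideal (MvPolynomial σ K)} {f : MvPolynomial σ K}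
    (hJ' : J' = J ⊔ Ideal.span {f}) (hnzd : ∀ g, g * f ∈ J → g ∈ J) :
    Function.Exact (F.coneD f 0) (F.coneε f hJ') := by
  intro y
  rw [← Submodule.coe_eq_zero, coe_coneε]
  constructor
  · intro hy
    have h1 : (splitEquiv σ K _ _ y).2 default ∈ J := by
      refine hnzd _ ?_
      rw [mul_comm, eq_neg_of_add_eq_zero_right hy]
      exact neg_mem ((F.mem_range_augD_zero _).mp ⟨_, rfl⟩)
    obtain ⟨w, hw⟩ := (F.mem_range_augD_zero _).mpr h1
    have h3 : F.augD 0 ((splitEquiv σ K _ _ y).1 + f • w) = 0 := by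
      funext a
      rw [Subsingleton.elim a default, map_add, map_smul, hw]
      exact hy
    obtain ⟨z, hz⟩ := (F.augD_exact 0 _).mp h3
    refine ⟨(splitEquiv σ K _ _).symm (z, -w), (splitEquiv σ K _ _).injective ?_⟩
    rw [splitEquiv_coneD, LinearEquiv.apply_symm_apply]
    refine Prod.ext ?_ ?_
    · simp [hz]
    · simp [hw]
  · rintro ⟨x, rfl⟩
    rw [splitEquiv_coneD]
    simp [(F.augD_exact 0).apply_apply_eq_zero]

lemma coneε_surjective {J' : Ideal (MvPolynomial σ K)} {f : MvPolynomial σ K}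
    (hJ' : J' = J ⊔ Ideal.span {f}) : Function.Surjective (F.coneε f hJ') := by
  rintro ⟨y, hy⟩
  have hy' := hy
  rw [hJ'] at hy'
  obtain ⟨g, hg, h, hh, rfl⟩ := Submodule.mem_sup.mp hy'
  obtain ⟨a, rfl⟩ := Ideal.mem_span_singleton'.mp hh
  obtain ⟨w, hw⟩ := (F.mem_range_augD_zero (fun _ => g)).mpr hg
  refine ⟨(splitEquiv σ K _ _).symm (w, fun _ => a), Subtype.ext ?_⟩
  rw [coe_coneε, LinearEquiv.apply_symm_apply]
  simp [hw, mul_comm]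

lemma coneε_homogeneous {J' : Ideal (MvPolynomial σ K)} {f : MvPolynomial σ K}
    (hJ' : J' = J ⊔ Ideal.span {f}) {n : ℤ} (hf : f ∈ polyGrading σ K n) (b) :
    F.coneε f hJ' (Pi.single b 1) ∈ idealGrading J' (F.coneDeg n 0 b) := by
  change (F.coneε f hJ' (Pi.single b 1) : MvPolynomial σ K) ∈ polyGrading σ K _
  rw [coe_coneε]
  refine Fin.addCases (fun b => ?_) (fun b => ?_) b
  · rw [splitEquiv_single_castAdd]
    have := F.augD_homogeneous 0 b default
    rw [show F.augDeg 0 default = 0 from rfl, sub_zero] at this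
    rw [coneDeg, Fin.append_left]
    simpa using this
  · rw [splitEquiv_single_natAdd, Subsingleton.elim b default]
    rw [coneDeg, Fin.append_right, show F.augDeg 0 default = 0 from rfl, zero_add]
    simpa using hf

/-- The graded free resolution of `J + (f)` given by the cone of multiplication by `f`, for a
form `f` of degree `n` that is a nonzerodivisor modulo `J`. -/
noncomputable def cone {J' : Ideal (MvPolynomial σ K)} {f : MvPolynomial σ K}
    (hJ' : J' = J ⊔ Ideal.span {f}) {n : ℤ} (hf : f ∈ polyGrading σ K n)
    (hnzd : ∀ g, g * f ∈ J → g ∈ J) : GradedFreeResolution (σ := σ) (idealGrading J') where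
  rank i := F.augRank (i + 1) + F.augRank i
  deg i := F.coneDeg n i
  d i := F.coneD f i
  ε := F.coneε f hJ'
  d_homogeneous i := F.coneD_homogeneous hf i
  ε_homogeneous := F.coneε_homogeneous hJ' hf
  exact_d i := F.coneD_exact f i
  exact_ε := F.coneε_exact hJ' hnzd
  surjective_ε := F.coneε_surjective hJ'

lemma cone_isMinimal {F : GradedFreeResolution (σ := σ) (idealGrading J)} (hF : F.IsMinimal)
    {J' : Ideal (MvPolynomial σ K)} {f : MvPolynomial σ K}
    (hJ' : J' = J ⊔ Ideal.span {f}) {n : ℤ} (hf : f ∈ polyGrading σ K n)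
    (hnzd : ∀ g, g * f ∈ J → g ∈ J) (hf0 : constantCoeff f = 0)
    (hJ0 : J ≤ RingHom.ker constantCoeff) : (F.cone hJ' hf hnzd).IsMinimal := by
  suffices H : ∀ i x a, constantCoeff (F.coneD f i x a) = 0 from H
  intro i x a
  -- The augmentation is now one of the differentials of the cone, so its values, which lie in `J`,
  -- must have no constant term either.
  have h : ∀ i x a, constantCoeff (F.augD i x a) = 0 := by
    rintro (_ | i) x a
    · exact hJ0 (F.ε x).2
    · exact hF i x a
  refine Fin.addCases (fun a => ?_) (fun a => ?_) a
  · rw [coneD_castAdd, map_add, map_mul, hf0, h, zero_mul, add_zero]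
  · rw [coneD_natAdd, map_neg, h, neg_zero]

end GradedFreeResolution

end GradedBetti

/-! ### Finiteness of minimal graded free resolutions -/

namespace GradedBetti

open MvPolynomial

variable {σ K : Type*} [Field K]

lemma mem_span_X_of_X_mul_mem {s : Set σ} {t : σ} (ht : t ∉ s) {p : MvPolynomial σ K}
    (h : X t * p ∈ Ideal.span (X '' s)) : p ∈ Ideal.span (X '' s) := by
  classical
  rw [mem_ideal_span_X_image] at h ⊢
  intro m hm
  obtain ⟨i, hi, hmi⟩ := h (Finsupp.single t 1 + m) (by
    rw [mem_support_iff, X, coeff_monomial_mul, one_mul]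
    exact mem_support_iff.mp hm)
  refine ⟨i, hi, ?_⟩
  have : t ≠ i := fun h => ht (h ▸ hi)
  simpa [Finsupp.single_apply, this] using hmi

lemma map_apply_mem {m n : ℕ} {I : Ideal (MvPolynomial σ K)}
    (f : (Fin m → MvPolynomial σ K) →ₗ[MvPolynomial σ K] (Fin n → MvPolynomial σ K))
    {x : Fin m → MvPolynomial σ K} (hx : ∀ b, x b ∈ I) (a : Fin n) : f x a ∈ I := by
  rw [linearMap_apply_apply]
  exact Ideal.sum_mem _ fun b _ => Ideal.mul_mem_right _ _ (hx b)

namespace GradedFreeResolution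

variable {J : Ideal (MvPolynomial σ K)} (F : GradedFreeResolution (σ := σ) (idealGrading J))

/-- The augmented complex stays exact modulo the variables in `s`, in homological degrees at
least `#s`. -/
lemma exists_sub_augD_mem_span_X (s : Finset σ) (i : ℕ) (hi : s.card ≤ i)
    (x : Fin (F.augRank (i + 1)) → MvPolynomial σ K)
    (hx : ∀ a, F.augD i x a ∈ Ideal.span (X '' (s : Set σ))) :
    ∃ w, ∀ a, (x - F.augD (i + 1) w) a ∈ Ideal.span (X '' (s : Set σ)) := by
  classical
  induction s using Finset.induction_on generalizing i with
  | empty =>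
    have h0 : F.augD i x = 0 := funext fun a => by simpa using hx a
    obtain ⟨w, hw⟩ := (F.augD_exact i x).mp h0
    exact ⟨w, fun a => by simp [hw]⟩
  | @insert t s hts ih =>
    rw [Finset.card_insert_of_notMem hts] at hi
    obtain ⟨i, rfl⟩ : ∃ k, i = k + 1 := ⟨i - 1, by omega⟩
    have hspan : Ideal.span (X '' ((insert t s : Finset σ) : Set σ)) =
        Ideal.span {(X t : MvPolynomial σ K)} ⊔ Ideal.span (X '' (s : Set σ)) := by
      rw [Finset.coe_insert, Set.image_insert_eq, Ideal.span_insert]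
    rw [hspan] at hx ⊢
    have hdec : ∀ a, ∃ y z, z ∈ Ideal.span (X '' (s : Set σ)) ∧
        F.augD (i + 1) x a = X t * y + z := by
      intro a
      obtain ⟨y', hy', z, hz, h⟩ := Submodule.mem_sup.mp (hx a)
      obtain ⟨y, rfl⟩ := Ideal.mem_span_singleton.mp hy'
      exact ⟨y, z, hz, h.symm⟩
    choose y z hz hyz using hdec
    have hxyz : F.augD (i + 1) x = (X t : MvPolynomial σ K) • y + z := funext hyz
    -- Apply `∂` to `∂x = x_t y + z`: since `x_t` is a nonzerodivisor modulo the variables in `s`,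
    -- `y` is a cycle modulo `s`. If `y ≡ ∂w`, then `x - x_t w` is a cycle modulo `s`.
    have hy : ∀ a, F.augD i y a ∈ Ideal.span (X '' (s : Set σ)) := by
      intro a
      refine mem_span_X_of_X_mul_mem (by simpa using hts) ?_
      have h0 := congrFun ((F.augD_exact i).apply_apply_eq_zero x) a
      rw [hxyz, map_add, map_smul] at h0
      have h1 : X t * F.augD i y a = -F.augD i z a := eq_neg_of_add_eq_zero_left h0
      rw [h1]
      exact neg_mem (map_apply_mem _ hz a)
    obtain ⟨w, hw⟩ := ih i (by omega) y hy
    obtain ⟨w', hw'⟩ := ih (i + 1) (by omega) (x - (X t : MvPolynomial σ K) • w) fun a => by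
      have : F.augD (i + 1) (x - (X t : MvPolynomial σ K) • w) a =
          X t * (y - F.augD (i + 1) w) a + z a := by
        rw [map_sub, map_smul, hxyz]
        simp only [Pi.sub_apply, Pi.add_apply, Pi.smul_apply, smul_eq_mul]
        ring
      rw [this]
      exact add_mem (Ideal.mul_mem_left _ _ (hw a)) (hz a)
    refine ⟨w', fun a => ?_⟩
    have : (x - F.augD (i + 1 + 1) w') a =
        X t * w a + (x - (X t : MvPolynomial σ K) • w - F.augD (i + 1 + 1) w') a := by
      simp only [Pi.sub_apply, Pi.smul_apply, smul_eq_mul]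
      ring
    rw [this]
    exact add_mem (Ideal.mem_sup_left (Ideal.mul_mem_right _ _ (Ideal.subset_span rfl)))
      (Ideal.mem_sup_right (hw' a))

lemma mem_span_range_X_iff {p : MvPolynomial σ K} :
    p ∈ Ideal.span (X '' (Set.univ : Set σ)) ↔ constantCoeff p = 0 := by
  rw [mem_ideal_span_X_image, constantCoeff_eq, ← notMem_support_iff]
  constructor
  · intro h h0
    obtain ⟨i, _, hi⟩ := h 0 h0
    exact hi rfl
  · intro h m hm
    have : m ≠ 0 := by rintro rfl; exact h hm
    obtain ⟨i, hi⟩ := Finsupp.ne_iff.mp this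
    exact ⟨i, trivial, hi⟩

/-- Hilbert's syzygy theorem for minimal resolutions of ideals. -/
theorem IsMinimal.rank_eq_zero [Finite σ]
    {F : GradedFreeResolution (σ := σ) (idealGrading J)} (hF : F.IsMinimal) (i : ℕ)
    (hi : Nat.card σ ≤ i + 1) : F.rank (i + 1) = 0 := by
  classical
  have := Fintype.ofFinite σ
  by_contra hne
  let a : Fin (F.augRank (i + 1 + 1)) := ⟨0, Nat.pos_of_ne_zero hne⟩
  -- Modulo all variables the differentials vanish, so a basis vector would be a cycle, hence a
  -- boundary, hence zero.
  obtain ⟨w, hw⟩ := F.exists_sub_augD_mem_span_X Finset.univ (i + 1)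
    (by rwa [Finset.card_univ, ← Nat.card_eq_fintype_card]) (Pi.single a 1) fun b => by
      rw [Finset.coe_univ, mem_span_range_X_iff]
      exact hF i _ b
  have := hw a
  rw [Finset.coe_univ, mem_span_range_X_iff, Pi.sub_apply, map_sub] at this
  have h2 : constantCoeff (F.augD (i + 1 + 1) w a) = 0 := hF (i + 1) w a
  rw [h2] at this
  simp at this

end GradedFreeResolution

end GradedBetti

/-! ### Projective dimension and minimal resolutions -/

namespace GradedBetti

open MvPolynomial CategoryTheory

universe u v

section Rank

variable {σ K : Type*} [Field K] {r : ℕ → ℕ}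
  {d : ∀ i, (Fin (r (i + 1)) → MvPolynomial σ K) →ₗ[MvPolynomial σ K]
    (Fin (r i) → MvPolynomial σ K)}

lemma eq_zero_of_forall_constantCoeff {n : ℕ}
    (h : ∀ (x : Fin n → MvPolynomial σ K) a, constantCoeff (x a) = 0) : n = 0 := by
  classical
  by_contra hn
  have := h (Pi.single ⟨0, Nat.pos_of_ne_zero hn⟩ 1) ⟨0, Nat.pos_of_ne_zero hn⟩
  simp at this

/-- If `d i = 0`, all of `F_{i+1}` is the image of the next differential, which lies in `𝔪 F_{i+1}`.
-/
lemma rank_succ_eq_zero (hex : ∀ i, Function.Exact (d (i + 1)) (d i))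
    (hmin : ∀ i x a, constantCoeff (d i x a) = 0) {i : ℕ} (h : ∀ x, d i x = 0) :
    r (i + 1) = 0 :=
  eq_zero_of_forall_constantCoeff fun x a => by
    obtain ⟨w, rfl⟩ := (hex i x).mp (h x)
    exact hmin _ w a

lemma rank_eq_zero_of_le (hex : ∀ i, Function.Exact (d (i + 1)) (d i))
    (hmin : ∀ i x a, constantCoeff (d i x a) = 0) {i : ℕ} (h : r i = 0) (j : ℕ) (hij : i ≤ j) :
    r j = 0 := by
  induction j, hij using Nat.le_induction with
  | base => exact h
  | succ j _ ih =>
    refine rank_succ_eq_zero hex hmin fun x => funext fun a => ?_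
    rw [ih] at a
    exact a.elim0

variable {M : Type*} [AddCommGroup M] [Module (MvPolynomial σ K) M]
  {ε : (Fin (r 0) → MvPolynomial σ K) →ₗ[MvPolynomial σ K] M}

lemma rank_zero_eq_zero (hε : Function.Exact (d 0) ε)
    (hmin : ∀ i x a, constantCoeff (d i x a) = 0) (h : ∀ x, ε x = 0) : r 0 = 0 :=
  eq_zero_of_forall_constantCoeff fun x a => by
    obtain ⟨w, rfl⟩ := (hε x).mp (h x)
    exact hmin _ w a

/-- A section of `ε` gives a projection `p` of `F_0` onto `N = im d_0 ⊆ 𝔪 F_0`, so `N = p N ⊆ 𝔪 N`.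
By Nakayama some `c ≡ 1` modulo `𝔪` kills `N`, and `N` is torsion-free. -/
lemma rank_one_eq_zero_of_projective [Finite σ] [Module.Projective (MvPolynomial σ K) M]
    (hex : ∀ i, Function.Exact (d (i + 1)) (d i)) (hε : Function.Exact (d 0) ε)
    (hs : Function.Surjective ε) (hmin : ∀ i x a, constantCoeff (d i x a) = 0) : r 1 = 0 := by
  classical
  obtain ⟨s, hs⟩ := Module.projective_lifting_property ε LinearMap.id hs
  have hs' : ∀ m, ε (s m) = m := LinearMap.congr_fun hs
  let p : (Fin (r 0) → MvPolynomial σ K) →ₗ[MvPolynomial σ K]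
    (Fin (r 0) → MvPolynomial σ K) := LinearMap.id - s ∘ₗ ε
  have hp : ∀ x, p x ∈ LinearMap.range (d 0) := fun x => (hε _).mp (by simp [p, hs'])
  obtain ⟨c, hc, hc0⟩ := Submodule.exists_sub_one_mem_and_smul_eq_zero_of_fg_of_le_smul
    (RingHom.ker (constantCoeff (σ := σ) (R := K))) (LinearMap.range (d 0))
    (IsNoetherian.noetherian _) (by
      rintro _ ⟨w, rfl⟩
      have h1 : p (d 0 w) = d 0 w := by simp [p, hε.apply_apply_eq_zero]
      rw [← h1, linearMap_apply_eq_sum p]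
      exact Submodule.sum_mem _ fun b _ => Submodule.smul_mem_smul (hmin 0 w b) (hp _))
  refine rank_succ_eq_zero hex hmin fun x => funext fun a => ?_
  have hc1 : c ≠ 0 := by
    rintro rfl
    simp at hc
  have := congrFun (hc0 _ ⟨x, rfl⟩) a
  simpa [hc1] using this

end Rank

/-- Dimension shifting: replace `M` by `ker ε`, resolved by the truncated complex. The cases `M = 0`
and `M` projective are the base. -/
theorem hasProjectiveDimensionLT_iff_rank {σ : Type v} {K : Type u} [Field K] [Finite σ]
    (n : ℕ) {M : Type max v u} [AddCommGroup M] [Module (MvPolynomial σ K) M] {r : ℕ → ℕ}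
    {d : ∀ i, (Fin (r (i + 1)) → MvPolynomial σ K) →ₗ[MvPolynomial σ K]
      (Fin (r i) → MvPolynomial σ K)}
    {ε : (Fin (r 0) → MvPolynomial σ K) →ₗ[MvPolynomial σ K] M}
    (hex : ∀ i, Function.Exact (d (i + 1)) (d i)) (hε : Function.Exact (d 0) ε)
    (hs : Function.Surjective ε) (hmin : ∀ i x a, constantCoeff (d i x a) = 0) :
    HasProjectiveDimensionLT (ModuleCat.of (MvPolynomial σ K) M) n ↔ ∀ i, n ≤ i → r i = 0 := by
  induction n generalizing M r with
  | zero =>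
    rw [hasProjectiveDimensionLT_zero_iff_isZero, ModuleCat.isZero_of_iff_subsingleton]
    constructor
    · intro h i _
      exact rank_eq_zero_of_le hex hmin
        (rank_zero_eq_zero hε hmin fun x => Subsingleton.elim _ _) i (Nat.zero_le i)
    · intro h
      refine subsingleton_of_forall_eq 0 fun m => ?_
      obtain ⟨x, rfl⟩ := hs m
      have : x = 0 := funext fun a => by
        rw [h 0 le_rfl] at a
        exact a.elim0
      rw [this, map_zero]
  | succ n ih =>
    cases n with
    | zero =>
      rw [zero_add, ← projective_iff_hasProjectiveDimensionLT_one, ← IsProjective.iff_projective]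
      constructor
      · intro h i hi
        exact rank_eq_zero_of_le hex hmin
          (rank_one_eq_zero_of_projective hex hε hs hmin) i hi
      · intro h
        refine Module.Projective.of_equiv (LinearEquiv.ofBijective ε ⟨?_, hs⟩)
        refine (injective_iff_map_eq_zero ε).mpr fun x hx => ?_
        obtain ⟨w, rfl⟩ := (hε x).mp hx
        have : w = 0 := funext fun a => by
          rw [h 1 le_rfl] at a
          exact a.elim0
        rw [this, map_zero]
    | succ n =>
      have hS := LinearMap.shortExact_shortComplexKer hs
      refine (hS.hasProjectiveDimensionLT_X₃_iff n ?_).trans ?_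
      · exact inferInstanceAs (Projective (ModuleCat.of (MvPolynomial σ K)
          (Fin (r 0) → MvPolynomial σ K)))
      · refine (ih (M := LinearMap.ker ε) (r := fun i => r (i + 1)) (d := fun i => d (i + 1))
          (ε := (d 0).codRestrict (LinearMap.ker ε) fun x => hε.apply_apply_eq_zero x)
          (fun i => hex (i + 1)) (fun x => ?_) (fun y => ?_) (fun i => hmin (i + 1))).trans ?_
        · rw [← hex 0 x, Subtype.ext_iff]; rfl
        · obtain ⟨w, hw⟩ := (hε y.1).mp y.2
          exact ⟨w, Subtype.ext hw⟩
        · constructor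
          · intro h i hi
            obtain ⟨i, rfl⟩ : ∃ k, i = k + 1 := ⟨i - 1, by omega⟩
            exact h i (by omega)
          · intro h i hi
            exact h (i + 1) (by omega)

theorem GradedFreeResolution.IsMinimal.projectiveDimension_eq {σ : Type v} {K : Type u} [Field K]
    [Finite σ] {J : Ideal (MvPolynomial σ K)}
    {F : GradedFreeResolution (σ := σ) (idealGrading J)} (hF : F.IsMinimal) {n : ℕ}
    (hn : F.rank n ≠ 0) (hn' : ∀ i, n < i → F.rank i = 0) :
    projectiveDimension (ModuleCat.of (MvPolynomial σ K) J) = n := by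
  have key := fun n => hasProjectiveDimensionLT_iff_rank n F.exact_d F.exact_ε F.surjective_ε hF
  refine le_antisymm ?_ ?_
  · rw [projectiveDimension_le_iff]
    exact (key (n + 1)).mpr hn'
  · rw [projectiveDimension_ge_iff, key]
    exact fun h => hn (h n le_rfl)

end GradedBetti

/-! ### Invariants of minimal resolutions of ideals and of their cones -/

namespace GradedBetti

open MvPolynomial CategoryTheory

variable {σ K : Type*} [Field K]

lemma one_le_degree_of_ne_zero {j : ℤ} {p : MvPolynomial σ K} (hp : p ∈ polyGrading σ K j)
    (h0 : p ≠ 0) (hc : constantCoeff p = 0) : 1 ≤ j := by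
  obtain ⟨m, hm⟩ := MvPolynomial.ne_zero_iff.mp h0
  have h1 : Finsupp.weight (fun _ : σ => (1 : ℤ)) m = j := hp hm
  have h2 : m ≠ 0 := by rintro rfl; exact hm hc
  have h3 : j ≠ 0 := by rwa [← h1, Ne, weight_one_eq_zero_iff]
  have h4 : 0 ≤ j := by
    rw [← h1, Finsupp.weight_apply]
    exact Finset.sum_nonneg fun a _ => by simp
  omega

namespace GradedFreeResolution

variable {J : Ideal (MvPolynomial σ K)} {F : GradedFreeResolution (σ := σ) (idealGrading J)}

lemma IsMinimal.rank_eq_zero_of_eq_bot (hF : F.IsMinimal) (hJ : J = ⊥) (i : ℕ) :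
    F.rank i = 0 := by
  subst hJ
  exact rank_eq_zero_of_le F.exact_d hF
    (rank_zero_eq_zero F.exact_ε hF fun x => Subsingleton.elim _ _) i (Nat.zero_le i)

lemma rank_zero_ne_zero (hJ : J ≠ ⊥) : F.rank 0 ≠ 0 := by
  intro h
  refine hJ ((Submodule.eq_bot_iff _).mpr fun y hy => ?_)
  obtain ⟨x, hx⟩ := F.surjective_ε ⟨y, hy⟩
  have : x = 0 := funext fun a => by
    rw [h] at a
    exact a.elim0
  rw [this, map_zero] at hx
  exact congrArg Subtype.val hx.symm

lemma IsMinimal.exists_last_rank [Finite σ] (hF : F.IsMinimal) (hJ : J ≠ ⊥) :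
    ∃ n, F.rank n ≠ 0 ∧ ∀ i, n < i → F.rank i = 0 := by
  classical
  have hzero : ∀ i, Nat.card σ < i → F.rank i = 0 := by
    intro i hi
    obtain ⟨i, rfl⟩ : ∃ k, i = k + 1 := ⟨i - 1, by omega⟩
    exact hF.rank_eq_zero i (by omega)
  refine ⟨Nat.findGreatest (fun i => F.rank i ≠ 0) (Nat.card σ),
    Nat.findGreatest_spec (P := fun i => F.rank i ≠ 0) (Nat.zero_le _) (rank_zero_ne_zero hJ),
    fun i hi => ?_⟩
  by_cases h : i ≤ Nat.card σ
  · simpa using Nat.findGreatest_is_greatest hi h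
  · exact hzero i (not_le.mp h)

lemma IsMinimal.betti_ne_zero_iff (hF : F.IsMinimal) (i : ℕ) (j : ℤ) :
    betti σ (idealGrading J) i j ≠ 0 ↔ ∃ a, F.deg i a = j := by
  rw [hF.betti_eq, Nat.card_ne_zero]
  exact ⟨fun h => ⟨h.1.some.1, h.1.some.2⟩, fun ⟨a, ha⟩ => ⟨⟨a, ha⟩, inferInstance⟩⟩

/-- The regularity of a nonzero ideal is attained. -/
lemma IsMinimal.regularity_isGreatest [Finite σ] (hF : F.IsMinimal) (hJ : J ≠ ⊥) :
    IsGreatest {r : ℤ | ∃ (i : ℕ) (j : ℤ), betti σ (idealGrading J) i j ≠ 0 ∧ r = j - i}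
      (regularity σ (idealGrading J)) := by
  obtain ⟨n, -, hn⟩ := hF.exists_last_rank hJ
  -- Finiteness is essential: `sSup` of an unbounded set of integers is the default value `0`.
  have hfin : {r : ℤ | ∃ (i : ℕ) (j : ℤ),
      betti σ (idealGrading J) i j ≠ 0 ∧ r = j - i}.Finite := by
    refine ((Set.finite_Iic n).biUnion fun i _ =>
      Set.finite_range fun a : Fin (F.rank i) => F.deg i a - i).subset ?_
    rintro _ ⟨i, j, hij, rfl⟩
    obtain ⟨a, rfl⟩ := (hF.betti_ne_zero_iff i j).mp hij
    refine Set.mem_biUnion (x := i) ?_ ⟨a, rfl⟩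
    by_contra hi
    rw [hn i (not_le.mp hi)] at a
    exact a.elim0
  refine ⟨Int.csSup_mem ?_ hfin.bddAbove, fun r hr => le_csSup hfin.bddAbove hr⟩
  exact ⟨_, 0, _, (hF.betti_ne_zero_iff 0 _).mpr
    ⟨⟨0, Nat.pos_of_ne_zero (rank_zero_ne_zero hJ)⟩, rfl⟩, rfl⟩

/-- A minimal generator is nonzero without constant term, hence of positive degree. This keeps the
new generator of degree `2` in the cone from exceeding the regularity of `J` plus one. -/
lemma IsMinimal.one_le_regularity [Finite σ] (hF : F.IsMinimal) (hJ : J ≠ ⊥)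
    (hJ0 : J ≤ RingHom.ker constantCoeff) : 1 ≤ regularity σ (idealGrading J) := by
  classical
  let a : Fin (F.rank 0) := ⟨0, Nat.pos_of_ne_zero (rank_zero_ne_zero hJ)⟩
  have h1 : (F.ε (Pi.single a 1) : MvPolynomial σ K) ≠ 0 := by
    intro h
    obtain ⟨w, hw⟩ := (F.exact_ε (Pi.single a 1)).mp (Subtype.ext h)
    have := hF 0 w a
    rw [hw] at this
    simp at this
  have h2 : 1 ≤ F.deg 0 a :=
    one_le_degree_of_ne_zero (F.ε_homogeneous a) h1 (hJ0 (F.ε (Pi.single a 1)).2)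
  have := (hF.regularity_isGreatest hJ).2
    ⟨0, F.deg 0 a, (hF.betti_ne_zero_iff 0 _).mpr ⟨a, rfl⟩, rfl⟩
  push_cast at this
  omega

end GradedFreeResolution

section Cone

variable {J J' : Ideal (MvPolynomial σ K)} {f : MvPolynomial σ K} {n : ℤ}
  {F : GradedFreeResolution (σ := σ) (idealGrading J)}

lemma betti_cone (hF : F.IsMinimal) (hJ' : J' = J ⊔ Ideal.span {f})
    (hf : f ∈ polyGrading σ K n) (hnzd : ∀ g, g * f ∈ J → g ∈ J) (hf0 : constantCoeff f = 0)
    (hJ0 : J ≤ RingHom.ker constantCoeff) (i : ℕ) (j : ℤ) :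
    betti σ (idealGrading J') i j =
      Nat.card {a // F.augDeg (i + 1) a = j} + Nat.card {a // F.augDeg i a = j - n} := by
  rw [(F.cone_isMinimal hF hJ' hf hnzd hf0 hJ0).betti_eq]
  refine (card_append_degree (F.augDeg (i + 1)) (fun a => F.augDeg i a + n) j).trans ?_
  simp only [eq_sub_iff_add_eq]

lemma betti_succ_cone (hF : F.IsMinimal) (hJ' : J' = J ⊔ Ideal.span {f})
    (hf : f ∈ polyGrading σ K n) (hnzd : ∀ g, g * f ∈ J → g ∈ J) (hf0 : constantCoeff f = 0)
    (hJ0 : J ≤ RingHom.ker constantCoeff) (i : ℕ) (j : ℤ) :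
    betti σ (idealGrading J') (i + 1) j =
      betti σ (idealGrading J) (i + 1) j + betti σ (idealGrading J) i (j - n) := by
  rw [betti_cone hF hJ' hf hnzd hf0 hJ0, hF.betti_eq, hF.betti_eq]
  rfl

lemma betti_zero_cone (hF : F.IsMinimal) (hJ' : J' = J ⊔ Ideal.span {f})
    (hf : f ∈ polyGrading σ K n) (hnzd : ∀ g, g * f ∈ J → g ∈ J) (hf0 : constantCoeff f = 0)
    (hJ0 : J ≤ RingHom.ker constantCoeff) (j : ℤ) :
    betti σ (idealGrading J') 0 j =
      betti σ (idealGrading J) 0 j + if j = n then 1 else 0 := by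
  rw [betti_cone hF hJ' hf hnzd hf0 hJ0, hF.betti_eq]
  have : Nat.card {a : Fin (F.augRank 0) // F.augDeg 0 a = j - n} = if j = n then 1 else 0 := by
    have h0 : ∀ a, F.augDeg 0 a = 0 := fun _ => rfl
    simp only [h0, eq_comm (a := (0 : ℤ)), sub_eq_zero]
    split_ifs with h
    · have := Unique.mk' (Fin (F.augRank 0))
      simp [h]
    · simp [h]
  rw [this]
  rfl

lemma projectiveDimension_cone [Finite σ] (hF : F.IsMinimal) (hJ' : J' = J ⊔ Ideal.span {f})
    (hf : f ∈ polyGrading σ K n) (hnzd : ∀ g, g * f ∈ J → g ∈ J) (hf0 : constantCoeff f = 0)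
    (hJ0 : J ≤ RingHom.ker constantCoeff) (hJ : J ≠ ⊥) :
    projectiveDimension (ModuleCat.of (MvPolynomial σ K) J') =
      projectiveDimension (ModuleCat.of (MvPolynomial σ K) J) + 1 := by
  obtain ⟨m, hm, hm'⟩ := hF.exists_last_rank hJ
  have hcone := F.cone_isMinimal hF hJ' hf hnzd hf0 hJ0
  rw [hF.projectiveDimension_eq hm hm', hcone.projectiveDimension_eq (n := m + 1) ?_ ?_]
  · push_cast; rfl
  · change F.rank (m + 1) + F.rank m ≠ 0
    omega
  · intro i hi
    obtain ⟨i, rfl⟩ : ∃ k, i = k + 1 := ⟨i - 1, by omega⟩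
    change F.rank (i + 1) + F.rank i = 0
    rw [hm' _ (by omega), hm' _ (by omega)]

lemma projectiveDimension_cone_of_eq_bot [Finite σ] (hF : F.IsMinimal)
    (hJ' : J' = J ⊔ Ideal.span {f})
    (hf : f ∈ polyGrading σ K n) (hnzd : ∀ g, g * f ∈ J → g ∈ J) (hf0 : constantCoeff f = 0)
    (hJ0 : J ≤ RingHom.ker constantCoeff) (hJ : J = ⊥) :
    projectiveDimension (ModuleCat.of (MvPolynomial σ K) J') = 0 := by
  have hcone := F.cone_isMinimal hF hJ' hf hnzd hf0 hJ0
  have hr := hF.rank_eq_zero_of_eq_bot hJ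
  refine hcone.projectiveDimension_eq (n := 0) ?_ ?_
  -- The summand `1` is the rank of `S` in the augmented complex, that is, the generator `f`.
  · change F.rank 0 + 1 ≠ 0
    omega
  · intro i hi
    obtain ⟨i, rfl⟩ : ∃ k, i = k + 1 := ⟨i - 1, by omega⟩
    change F.rank (i + 1) + F.rank i = 0
    rw [hr, hr]

/-- The shifted copy moves a basis vector from `(i, j)` to `(i + 1, j + 2)`, raising `j - i` by one;
the unshifted copy stays below that bound. -/
lemma regularity_cone [Finite σ] (hF : F.IsMinimal) (hJ' : J' = J ⊔ Ideal.span {f})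
    (hf : f ∈ polyGrading σ K 2) (hnzd : ∀ g, g * f ∈ J → g ∈ J) (hf0 : constantCoeff f = 0)
    (hJ0 : J ≤ RingHom.ker constantCoeff) (hJ : J ≠ ⊥) :
    regularity σ (idealGrading J') = regularity σ (idealGrading J) + 1 := by
  obtain ⟨⟨i, j, hij, hreg⟩, hub⟩ := hF.regularity_isGreatest hJ
  have hpos := hF.one_le_regularity hJ hJ0
  refine IsGreatest.csSup_eq ⟨⟨i + 1, j + 2, ?_, ?_⟩, ?_⟩
  · rw [betti_succ_cone hF hJ' hf hnzd hf0 hJ0, add_sub_cancel_right]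
    omega
  · rw [hreg]; push_cast; ring
  · rintro _ ⟨i, j, hij, rfl⟩
    obtain _ | i := i
    · rw [betti_zero_cone hF hJ' hf hnzd hf0 hJ0] at hij
      by_cases hj : j = 2
      · push_cast; omega
      · rw [if_neg hj, add_zero] at hij
        have := hub ⟨0, j, hij, rfl⟩
        omega
    · rw [betti_succ_cone hF hJ' hf hnzd hf0 hJ0] at hij
      by_cases h : betti σ (idealGrading J) i (j - 2) = 0
      · rw [h, add_zero] at hij
        have := hub ⟨i + 1, j, hij, rfl⟩
        omega
      · have := hub ⟨i, j - 2, h, rfl⟩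
        push_cast
        omega

lemma regularity_cone_of_eq_bot (hF : F.IsMinimal) (hJ' : J' = J ⊔ Ideal.span {f})
    (hf : f ∈ polyGrading σ K n) (hnzd : ∀ g, g * f ∈ J → g ∈ J) (hf0 : constantCoeff f = 0)
    (hJ0 : J ≤ RingHom.ker constantCoeff) (hJ : J = ⊥) :
    regularity σ (idealGrading J') = n := by
  have hb : ∀ i j, betti σ (idealGrading J) i j = 0 := by
    intro i j
    by_contra h
    obtain ⟨a, -⟩ := (hF.betti_ne_zero_iff i j).mp h
    rw [hF.rank_eq_zero_of_eq_bot hJ] at a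
    exact a.elim0
  refine IsGreatest.csSup_eq ⟨⟨0, n, ?_, by simp⟩, ?_⟩
  · rw [betti_zero_cone hF hJ' hf hnzd hf0 hJ0]; simp
  · rintro _ ⟨i, j, hij, rfl⟩
    obtain _ | i := i
    · rw [betti_zero_cone hF hJ' hf hnzd hf0 hJ0, hb] at hij
      have : j = n := by by_contra h; simp [h] at hij
      simp [this]
    · rw [betti_succ_cone hF hJ' hf hnzd hf0 hJ0, hb, hb] at hij
      exact absurd rfl hij

end Cone

end GradedBetti

/-! ### Vanishing and homogeneity of binomial edge ideals -/

namespace BinomialEdgeIdeal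

open MvPolynomial GradedBetti

variable {K : Type*} [Field K] {V : Type*}

lemma edgeBinomial_ne_zero {v w : V} (h : v ≠ w) : edgeBinomial K v w ≠ 0 := by
  classical
  intro h0
  -- At the point with `x_v = y_w = 1` and all other coordinates `0`, the binomial takes the value
  -- `1`.
  have := congrArg (eval (Sum.elim (Pi.single v (1 : K)) (Pi.single w 1))) h0
  simp [edgeBinomial, h.symm] at this

lemma binomialEdgeIdeal_eq_bot_iff {G : SimpleGraph V} : binomialEdgeIdeal K G = ⊥ ↔ G = ⊥ := by
  constructor
  · intro h
    refine SimpleGraph.ext (funext fun v => funext fun w => propext ⟨fun hvw => ?_, False.elim⟩)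
    have := edgeBinomial_mem (K := K) hvw
    rw [h] at this
    exact edgeBinomial_ne_zero hvw.ne this
  · rintro rfl
    refine Ideal.span_eq_bot.mpr ?_
    rintro _ ⟨v, w, h, -⟩
    exact h.elim

lemma weightedHomogeneousComponent_mem_binomialEdgeIdeal {G : SimpleGraph V}
    {g : MvPolynomial (V ⊕ V) K} (hg : g ∈ binomialEdgeIdeal K G) (n : ℤ) :
    weightedHomogeneousComponent (fun _ => (1 : ℤ)) n g ∈ binomialEdgeIdeal K G := by
  refine weightedHomogeneousComponent_mem_span ?_ hg n
  rintro _ ⟨v, w, -, rfl⟩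
  exact ⟨2, isWeightedHomogeneous_edgeBinomial v w⟩

end BinomialEdgeIdeal

theorem mainTheorem8 (K : Type*) [Field K] {V : Type*} [Finite V] (G : SimpleGraph V)
    (e : Sym2 V) (he : G.IsFreeCutEdge e) :
    (∀ (i : ℕ) (j : ℤ), 1 ≤ i → 1 ≤ j →
      BinomialEdgeIdeal.bettiJ K G i j =
        BinomialEdgeIdeal.bettiJ K (G.deleteEdges {e}) i j +
          BinomialEdgeIdeal.bettiJ K (G.deleteEdges {e}) (i - 1) (j - 2)) ∧
    (G.deleteEdges {e} ≠ ⊥ →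
      BinomialEdgeIdeal.pdJ K G = BinomialEdgeIdeal.pdJ K (G.deleteEdges {e}) + 1 ∧
      BinomialEdgeIdeal.regJ K G = BinomialEdgeIdeal.regJ K (G.deleteEdges {e}) + 1) ∧
    (G.deleteEdges {e} = ⊥ →
      BinomialEdgeIdeal.pdJ K G = 0 ∧ BinomialEdgeIdeal.regJ K G = 2) := by
  induction e using Sym2.ind with
  | _ u v =>
  have hJ' := BinomialEdgeIdeal.binomialEdgeIdeal_deleteEdges_sup (K := K) he.1.1
  have hf := BinomialEdgeIdeal.isWeightedHomogeneous_edgeBinomial (K := K) u v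
  have hf0 : MvPolynomial.constantCoeff (BinomialEdgeIdeal.edgeBinomial K u v) = 0 :=
    GradedBetti.constantCoeff_eq_zero_of_mem_polyGrading hf two_ne_zero
  have hnzd : ∀ g, g * BinomialEdgeIdeal.edgeBinomial K u v ∈
      BinomialEdgeIdeal.binomialEdgeIdeal K (G.deleteEdges {s(u, v)}) →
      g ∈ BinomialEdgeIdeal.binomialEdgeIdeal K (G.deleteEdges {s(u, v)}) := fun g hg =>
    BinomialEdgeIdeal.mem_of_mul_edgeBinomial_mem he.1.not_reachable
      (he.2 u (Sym2.mem_mk_left u v)).adj_of_adj (he.2 v (Sym2.mem_mk_right u v)).adj_of_adj hg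
  have hJ0 := BinomialEdgeIdeal.binomialEdgeIdeal_le_constantCoeff_ker (K := K)
    (G.deleteEdges {s(u, v)})
  obtain ⟨F, hF⟩ := GradedBetti.exists_isMinimal
    (J := BinomialEdgeIdeal.binomialEdgeIdeal K (G.deleteEdges {s(u, v)})) fun _ hg n =>
      BinomialEdgeIdeal.weightedHomogeneousComponent_mem_binomialEdgeIdeal hg n
  refine ⟨fun i j hi _ => ?_, fun h => ?_, fun h => ?_⟩
  · obtain ⟨i, rfl⟩ : ∃ k, i = k + 1 := ⟨i - 1, by omega⟩
    exact GradedBetti.betti_succ_cone hF hJ' hf hnzd hf0 hJ0 i j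
  · have hJ := BinomialEdgeIdeal.binomialEdgeIdeal_eq_bot_iff (K := K).not.mpr h
    exact ⟨GradedBetti.projectiveDimension_cone hF hJ' hf hnzd hf0 hJ0 hJ,
      GradedBetti.regularity_cone hF hJ' hf hnzd hf0 hJ0 hJ⟩
  · have hJ := BinomialEdgeIdeal.binomialEdgeIdeal_eq_bot_iff (K := K).mpr h
    exact ⟨GradedBetti.projectiveDimension_cone_of_eq_bot hF hJ' hf hnzd hf0 hJ0 hJ,
      GradedBetti.regularity_cone_of_eq_bot hF hJ' hf hnzd hf0 hJ0 hJ⟩
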